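/- Let $\mathfrak{Lie}$ be the Lie operad over $\mathbb{Q}$, and let $\mathbf{Cat}\,\mathfrak{Lie}$ be the associated $\mathbb{Q}$-linear category (PROP): its objects are the natural numbers, and $$\mathbf{Cat}\,\mathfrak{Lie}(m,n)=\bigoplus_{f:\{1,\dots,m\}\twoheadrightarrow\{1,\dots,n\}}\ \bigotimes_{i=1}^n \mathfrak{Lie}(f^{-1}(i)),$$ with composition induced by operadic composition. A $\mathbf{Cat}\,\mathfrak{Lie}$-bimodule is a family of $\mathbb{Q}$-vector spaces $B(m,n)$ with a left action (covariant in $n$) and a right action (contravariant in $m$) of $\mathbf{Cat}\,\mathfrak{Lie}$ which are $\mathbb{Q}$-bilinear, unital, associative and commute with each other. Let $\delta\mathbf{Cat}\,\mathfrak{Lie}(m,n)=\mathbf{Cat}\,\mathfrak{Lie}(m,n+1)$ be the bimodule on which $\phi\in\mathbf{Cat}\,\mathfrak{Lie}(n,n')$ acts on the left by composition with $\phi\boxplus 1$, and on which the right action is composition. Let $\delta^{(1)}\mathbf{Cat}\,\mathfrak{Lie}(m,n)\subset\delta\mathbf{Cat}\,\mathfrak{Lie}(m,n)$ be the sum of the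 terms indexed by the surjections $f:\{1,\dots,m\}\twoheadrightarrow\{1,\dots,n+1\}$ with $|f^{-1}(n+1)|=1$. Let $\pi:\delta\mathbf{Cat}\,\mathfrak{Lie}\to\delta^{(1)}\mathbf{Cat}\,\mathfrak{Lie}$ be the following family of linear maps. Write an element of $\delta\mathbf{Cat}\,\mathfrak{Lie}(m,n)$ as a sum of terms $\mathfrak{Z}\otimes \ell$, where $\mathfrak{Z}=Z_1\otimes\dots\otimes Z_n$ consists of the first $n$ tensor factors and $\ell$ is the last one. Expand $\ell$ in the associative operad (brackets are sent to commutators) as a linear combination of words $x_1\cdots x_k x$ in the input letters, $k\ge 0$. Then $\pi(\mathfrak{Z}\otimes\ell)$ is the corresponding linear combination of the elements $(\mathfrak{Z}\cdot x_1\cdots x_k)\otimes x$, where a letter $y$ acts on the right by $\mathfrak{Z}\cdot y=\sum_{i=1}^n Z_1\otimes\dots\otimes[Z_i,y]\otimes\dots\otimes Z_n$. Then: 1. Adjoining a leaf induces an isomorphism $\mathbf{Cat}\,\mathfrak{Lie}\odot I\cong\delta^{(1)}\mathbf{Cat}\,\mathfrak{Lie}$ that is compatible with the left $\mathbf{Cat}\,\mathfrak{Lie}$-action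 and the right action of the symmetric groups. Here $I$ is the unit operad, and $(\mathbf{Cat}\,\mathfrak{Lie}\odot I)(m,n)=\bigoplus_{A\subseteq\{1,\dots,m\}}\mathbf{Cat}\,\mathfrak{Lie}(A,n)\otimes I(\{1,\dots,m\}\setminus A)$. 2. $\pi$ restricts to the identity on $\delta^{(1)}\mathbf{Cat}\,\mathfrak{Lie}$. 3. There is a unique $\mathbf{Cat}\,\mathfrak{Lie}$-bimodule structure on $\delta^{(1)}\mathbf{Cat}\,\mathfrak{Lie}$ for which $\pi:\delta\mathbf{Cat}\,\mathfrak{Lie}\twoheadrightarrow\delta^{(1)}\mathbf{Cat}\,\mathfrak{Lie}$ is a morphism of $\mathbf{Cat}\,\mathfrak{Lie}$-bimodules. 4. In this structure, the left action is the restriction of the left action on $\delta\mathbf{Cat}\,\mathfrak{Lie}$. The right action of $\phi\in\mathbf{Cat}\,\mathfrak{Lie}(m',m)$ sends $z\in\delta^{(1)}\mathbf{Cat}\,\mathfrak{Lie}(m,n)$ to $\pi(z\circ\phi)$, where $z\circ\phi\in\mathbf{Cat}\,\mathfrak{Lie}(m',n+1)$ is the composite in $\mathbf{Cat}\,\mathfrak{Lie}$.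 -/

import Mathlib

open CategoryTheory
open scoped TensorProduct

noncomputable section

/-! ### Bimodules over a `ℚ`-linear category -/

/-- A bimodule structure over the `ℚ`-linear category `C` on a family `B m n` of `ℚ`-vector
spaces, covariant in `n` (left action) and contravariant in `m` (right action); that is, a
structure of `ℚ`-linear functor from `C ⊗ Cᵒᵖ` to `ℚ`-vector spaces. -/
@[ext]
structure LinearBimodule (C : Type) [Category.{0} C] [Preadditive C] [Linear ℚ C]
    (B : C → C → Type) [∀ m n, AddCommGroup (B m n)] [∀ m n, Module ℚ (B m n)] where
  /-- the left action `φ · b` -/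
  lact : ∀ {m n n' : C}, (n ⟶ n') →ₗ[ℚ] B m n →ₗ[ℚ] B m n'
  /-- the right action `b · φ` -/
  ract : ∀ {m' m n : C}, B m n →ₗ[ℚ] (m' ⟶ m) →ₗ[ℚ] B m' n
  id_lact : ∀ {m n : C} (b : B m n), lact (𝟙 n) b = b
  comp_lact : ∀ {m n n' n'' : C} (φ : n ⟶ n') (ψ : n' ⟶ n'') (b : B m n),
    lact (φ ≫ ψ) b = lact ψ (lact φ b)
  ract_id : ∀ {m n : C} (b : B m n), ract b (𝟙 m) = b
  ract_comp : ∀ {m'' m' m n : C} (b : B m n) (ψ : m'' ⟶ m') (φ : m' ⟶ m),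
    ract b (ψ ≫ φ) = ract (ract b φ) ψ
  lact_ract : ∀ {m' m n n' : C} (φ : n ⟶ n') (b : B m n) (ψ : m' ⟶ m),
    lact φ (ract b ψ) = ract (lact φ b) ψ

namespace LinearBimodule

variable {C : Type} [Category.{0} C] [Preadditive C] [Linear ℚ C]

/-- A family of linear maps is a morphism of bimodules when it commutes with both actions. -/
structure IsMorphism {B B' : C → C → Type}
    [∀ m n, AddCommGroup (B m n)] [∀ m n, Module ℚ (B m n)]
    [∀ m n, AddCommGroup (B' m n)] [∀ m n, Module ℚ (B' m n)]
    (X : LinearBimodule C B) (X' : LinearBimodule C B')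
    (f : ∀ m n, B m n →ₗ[ℚ] B' m n) : Prop where
  map_lact : ∀ {m n n' : C} (φ : n ⟶ n') (b : B m n), f m n' (X.lact φ b) = X'.lact φ (f m n b)
  map_ract : ∀ {m' m n : C} (b : B m n) (φ : m' ⟶ m), f m' n (X.ract b φ) = X'.ract (f m n b) φ

/-- The category `C` as a bimodule over itself, through composition. -/
def regular (C : Type) [Category.{0} C] [Preadditive C] [Linear ℚ C] :
    LinearBimodule C (fun m n : C => (m ⟶ n)) where
  lact {m n n'} := (Linear.comp (S := ℚ) m n n').flip
  ract {m' m n} := (Linear.comp (S := ℚ) m' m n).flip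
  id_lact b := by simp
  comp_lact φ ψ b := by simp
  ract_id b := by simp
  ract_comp b ψ φ := by simp
  lact_ract φ b ψ := by simp

/-- Restriction of the left action along a linear endofunctor. -/
def pullLeft {B : C → C → Type} [∀ m n, AddCommGroup (B m n)] [∀ m n, Module ℚ (B m n)]
    (X : LinearBimodule C B) (F : C ⥤ C) [F.Additive] [F.Linear ℚ] :
    LinearBimodule C (fun m n : C => B m (F.obj n)) where
  lact {m n n'} := X.lact ∘ₗ F.mapLinearMap ℚ
  ract {m' m n} := X.ract
  id_lact b := by simp [X.id_lact]
  comp_lact φ ψ b := by simp [X.comp_lact]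
  ract_id b := X.ract_id b
  ract_comp b ψ φ := X.ract_comp b ψ φ
  lact_ract φ b ψ := X.lact_ract _ b ψ

end LinearBimodule

/-! ### Trees and forests

The arity `S` component of the Lie operad, for a finite set `S`, is spanned by the binary trees
(iterated brackets) whose leaves are labelled bijectively by `S`, modulo antisymmetry and the
Jacobi identity applied at any vertex.  The space of morphisms from `S` to `T` in the associated
PROP, that is `⨁_{f : S ↠ T} ⨂_{t ∈ T} Lie (f⁻¹ t)`, is therefore spanned by the forests
`F : T → trees` in which each `s ∈ S` labels exactly one leaf (the surjection `f` sends `s` to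
the index of the tree that contains `s`), modulo the same relations in each single tree. -/

namespace LieForest

/-- The number of leaves labelled `s` of a binary tree with leaves labelled by `S`. -/
def occ {S : Type} [DecidableEq S] (s : S) : FreeMagma S → ℕ
  | FreeMagma.of x => if x = s then 1 else 0
  | FreeMagma.mul a b => occ s a + occ s b

/-- The lists of trees whose sum is zero by one use of antisymmetry or of the Jacobi identity
at some vertex of the tree. -/
inductive TreeRel {S : Type} : List (FreeMagma S) → Prop
  | anti (a b : FreeMagma S) : TreeRel [a * b, b * a]
  | jacobi (a b c : FreeMagma S) : TreeRel [a * (b * c), b * (c * a), c * (a * b)]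
  | left {l : List (FreeMagma S)} (c : FreeMagma S) : TreeRel l → TreeRel (l.map fun a => a * c)
  | right {l : List (FreeMagma S)} (c : FreeMagma S) : TreeRel l → TreeRel (l.map fun a => c * a)

/-- Each letter labels exactly one leaf of the forest `F`. -/
def IsMultilinear {S T : Type} [DecidableEq S] [Fintype T] (F : T → FreeMagma S) : Prop :=
  ∀ s, ∑ t, occ s (F t) = 1

/-- Multilinear forests. -/
abbrev Forest (S T : Type) [DecidableEq S] [Fintype T] : Type :=
  {F : T → FreeMagma S // IsMultilinear F}

open Classical in
/-- The basis vector of a multilinear forest (and `0` on forests that are not multilinear). -/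
def gen {S T : Type} [DecidableEq S] [Fintype T] (F : T → FreeMagma S) : Forest S T →₀ ℚ :=
  if h : IsMultilinear F then Finsupp.single ⟨F, h⟩ 1 else 0

/-- The span of the antisymmetry and Jacobi relations inside one tree of a multilinear forest. -/
def relations (S T : Type) [DecidableEq S] [Fintype T] [DecidableEq T] :
    Submodule ℚ (Forest S T →₀ ℚ) :=
  Submodule.span ℚ {r | ∃ (F : T → FreeMagma S) (t : T) (l : List (FreeMagma S)),
    TreeRel l ∧ (∀ a ∈ l, IsMultilinear (Function.update F t a)) ∧
      r = (l.map fun a => gen (Function.update F t a)).sum}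

/-- Morphisms from `S` to `T` in the PROP of the Lie operad. -/
abbrev Hom (S T : Type) [DecidableEq S] [Fintype T] [DecidableEq T] : Type :=
  (Forest S T →₀ ℚ) ⧸ relations S T

/-- The class of a multilinear forest (and `0` on forests that are not multilinear). -/
def cls {S T : Type} [DecidableEq S] [Fintype T] [DecidableEq T] (F : T → FreeMagma S) :
    Hom S T :=
  (relations S T).mkQ (gen F)

/-- Grafting: the leaf `t` of the forest `F` is replaced by the tree `G t`. -/
def graft {S T U : Type} (G : T → FreeMagma S) (F : U → FreeMagma T) : U → FreeMagma S :=
  fun u => FreeMagma.lift G (F u)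

section Basic

set_option linter.unusedSectionVars false

variable {S T U : Type} [DecidableEq S] [DecidableEq T] [Fintype T] [DecidableEq U] [Fintype U]

@[simp] theorem occ_of {S : Type} [DecidableEq S] (s x : S) :
    occ s (FreeMagma.of x) = if x = s then 1 else 0 := rfl

@[simp] theorem occ_mul {S : Type} [DecidableEq S] (s : S) (a b : FreeMagma S) :
    occ s (a * b) = occ s a + occ s b := rfl

theorem TreeRel.occ_eq {S : Type} [DecidableEq S] {l : List (FreeMagma S)} (h : TreeRel l)
    (s : S) : ∀ a ∈ l, ∀ b ∈ l, occ s a = occ s b := by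
  induction h with
  | anti a b => simp; omega
  | jacobi a b c => simp; omega
  | left c _ ih =>
    simp only [List.mem_map]
    rintro _ ⟨a, ha, rfl⟩ _ ⟨b, hb, rfl⟩
    simp [ih a ha b hb]
  | right c _ ih =>
    simp only [List.mem_map]
    rintro _ ⟨a, ha, rfl⟩ _ ⟨b, hb, rfl⟩
    simp [ih a ha b hb]

theorem TreeRel.map_hom {S T : Type} (f : FreeMagma S →ₙ* FreeMagma T)
    {l : List (FreeMagma S)} (h : TreeRel l) : TreeRel (l.map f) := by
  induction h with
  | anti a b => simpa using TreeRel.anti (f a) (f b)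
  | jacobi a b c => simpa using TreeRel.jacobi (f a) (f b) (f c)
  | left c _ ih => simpa [Function.comp_def] using TreeRel.left (f c) ih
  | right c _ ih => simpa [Function.comp_def] using TreeRel.right (f c) ih

theorem isMultilinear_update {F : T → FreeMagma S} {t : T} {l : List (FreeMagma S)}
    (h : TreeRel l) {a b : FreeMagma S} (ha : a ∈ l) (hb : b ∈ l)
    (hF : IsMultilinear (Function.update F t a)) : IsMultilinear (Function.update F t b) := by
  intro s
  rw [← hF s]
  refine Finset.sum_congr rfl fun t' _ => ?_
  by_cases ht : t' = t
  · subst ht; simpa using h.occ_eq s b hb a ha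
  · simp [ht]

theorem cls_of_not {F : T → FreeMagma S} (h : ¬ IsMultilinear F) : cls F = 0 := by
  simp [cls, gen, h]

theorem cls_rel (F : T → FreeMagma S) (t : T) {l : List (FreeMagma S)} (h : TreeRel l) :
    (l.map fun a => cls (Function.update F t a)).sum = 0 := by
  by_cases hF : ∀ a ∈ l, IsMultilinear (Function.update F t a)
  · have : (relations S T).mkQ (l.map fun a => gen (Function.update F t a)).sum = 0 := by
      rw [Submodule.mkQ_apply, Submodule.Quotient.mk_eq_zero]
      exact Submodule.subset_span ⟨F, t, l, h, hF, rfl⟩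
    rw [map_list_sum, List.map_map] at this
    exact this
  · push Not at hF
    obtain ⟨a, ha, hFa⟩ := hF
    apply List.sum_eq_zero
    intro x hx
    obtain ⟨b, hb, rfl⟩ := List.mem_map.1 hx
    exact cls_of_not fun hb' => hFa (isMultilinear_update h hb ha hb')

/-- Linear maps out of `Hom S T` are functions on forests that respect the relations. -/
def liftHom {M : Type} [AddCommGroup M] [Module ℚ M] (f : (T → FreeMagma S) → M)
    (hf : ∀ (F : T → FreeMagma S) (t : T) (l : List (FreeMagma S)), TreeRel l →
      (l.map fun a => f (Function.update F t a)).sum = 0) : Hom S T →ₗ[ℚ] M :=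
  (relations S T).liftQ (Finsupp.linearCombination ℚ fun F : Forest S T => f F.1) (by
    rw [relations, Submodule.span_le]
    rintro _ ⟨F, t, l, hl, hF, rfl⟩
    simp only [SetLike.mem_coe, LinearMap.mem_ker, map_list_sum, List.map_map]
    rw [← hf F t l hl]
    congr 1
    refine List.map_congr_left fun a ha => ?_
    simp [gen, hF a ha])

@[simp] theorem liftHom_cls {M : Type} [AddCommGroup M] [Module ℚ M]
    (f : (T → FreeMagma S) → M) (hf) {F : T → FreeMagma S} (hF : IsMultilinear F) :
    liftHom f hf (cls F) = f F := by
  simp [liftHom, cls, gen, hF]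

theorem hom_ext {M : Type} [AddCommGroup M] [Module ℚ M] {f g : Hom S T →ₗ[ℚ] M}
    (h : ∀ F, IsMultilinear F → f (cls F) = g (cls F)) : f = g := by
  refine Submodule.linearMap_qext _ (Finsupp.lhom_ext' fun F => LinearMap.ext_ring ?_)
  simpa [cls, gen, F.2] using h F.1 F.2

theorem hom_induction {p : Hom S T → Prop} (hadd : ∀ x y, p x → p y → p (x + y))
    (hsmul : ∀ (c : ℚ) x, p x → p (c • x)) (hcls : ∀ F, IsMultilinear F → p (cls F))
    (h0 : p 0) (x : Hom S T) : p x := by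
  obtain ⟨x, rfl⟩ := Submodule.mkQ_surjective _ x
  induction x using Finsupp.induction_linear with
  | zero => simpa using h0
  | add f g hf hg => simpa using hadd _ _ hf hg
  | single F c =>
    have := hsmul c _ (hcls F.1 F.2)
    simpa [cls, gen, F.2, ← Submodule.Quotient.mk_smul] using this

theorem occ_lift (G : T → FreeMagma S) (s : S) (a : FreeMagma T) :
    occ s (FreeMagma.lift G a) = ∑ t, occ t a * occ s (G t) := by
  induction a with
  | ih1 x => simp
  | ih2 a b iha ihb => simp [iha, ihb, add_mul, Finset.sum_add_distrib]

theorem IsMultilinear.graft {G : T → FreeMagma S} {F : U → FreeMagma T}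
    (hG : IsMultilinear G) (hF : IsMultilinear F) : IsMultilinear (graft G F) := by
  intro s
  simp only [LieForest.graft, occ_lift]
  rw [Finset.sum_comm]
  simp only [← Finset.sum_mul, hF _, one_mul, hG s]

theorem lift_update_of_occ_zero (G : T → FreeMagma S) (t : T) (a : FreeMagma S)
    (b : FreeMagma T) (hb : occ t b = 0) :
    FreeMagma.lift (Function.update G t a) b = FreeMagma.lift G b := by
  induction b with
  | ih1 x =>
    have : x ≠ t := by simpa using hb
    simp [this]
  | ih2 b c ihb ihc =>
    simp only [occ_mul, Nat.add_eq_zero_iff] at hb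
    simp [ihb hb.1, ihc hb.2]

theorem TreeRel.lift_update (G : T → FreeMagma S) (t : T) {l : List (FreeMagma S)}
    (hl : TreeRel l) (b : FreeMagma T) (hb : occ t b = 1) :
    TreeRel (l.map fun a => FreeMagma.lift (Function.update G t a) b) := by
  induction b with
  | ih1 x =>
    have : x = t := by simpa using hb
    simpa [this] using hl
  | ih2 b c ihb ihc =>
    simp only [occ_mul] at hb
    rcases Nat.eq_zero_or_pos (occ t c) with hc | hc
    · simpa [lift_update_of_occ_zero _ _ _ c hc, Function.comp_def] using
        TreeRel.left (FreeMagma.lift G c) (ihb (by omega))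
    · have hb0 : occ t b = 0 := by omega
      simpa [lift_update_of_occ_zero _ _ _ b hb0, Function.comp_def] using
        TreeRel.right (FreeMagma.lift G b) (ihc (by omega))

/-- Composition in the PROP of the Lie operad: grafting of forests, extended bilinearly.
The first argument is the first morphism. -/
def comp (S T U : Type) [DecidableEq S] [DecidableEq T] [Fintype T] [DecidableEq U] [Fintype U] :
    Hom S T →ₗ[ℚ] Hom T U →ₗ[ℚ] Hom S U :=
  liftHom (fun G => liftHom (fun F => cls (graft G F)) (by
      intro F u l hl
      have := cls_rel (graft G F) u (hl.map_hom (FreeMagma.lift G))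
      rw [List.map_map] at this
      rw [← this]
      congr 1
      refine List.map_congr_left fun a _ => ?_
      simp only [Function.comp_apply]
      congr 1
      funext u'
      by_cases h : u' = u
      · subst h; simp [graft]
      · simp [graft, h])) (by
    intro G t l hl
    refine hom_ext fun F hF => ?_
    rw [← LinearMap.applyₗ_apply_apply (R := ℚ), map_list_sum, List.map_map]
    simp only [Function.comp_def, LinearMap.applyₗ_apply_apply, liftHom_cls _ _ hF,
      LinearMap.zero_apply]
    obtain ⟨u, hu⟩ : ∃ u, occ t (F u) ≠ 0 := by
      by_contra! h
      have := hF t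
      simp [h] at this
    have hsum := hF t
    rw [← Finset.add_sum_erase _ _ (Finset.mem_univ u)] at hsum
    have hu1 : occ t (F u) = 1 := by omega
    have h0 : ∑ x ∈ Finset.univ.erase u, occ t (F x) = 0 := by omega
    rw [Finset.sum_eq_zero_iff] at h0
    have := cls_rel (graft G F) u (hl.lift_update G t (F u) hu1)
    rw [List.map_map] at this
    rw [← this]
    congr 1
    refine List.map_congr_left fun a _ => ?_
    simp only [Function.comp_apply]
    congr 1
    funext u'
    by_cases h : u' = u
    · subst h; simp [graft]
    · simp only [graft, ne_eq, h, not_false_eq_true, Function.update_of_ne]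
      exact lift_update_of_occ_zero _ _ _ _ (h0 u' (by simp [h])))

theorem comp_cls {G : T → FreeMagma S} {F : U → FreeMagma T} (hG : IsMultilinear G)
    (hF : IsMultilinear F) : comp S T U (cls G) (cls F) = cls (graft G F) := by
  simp [comp, hG, hF]

/-- The morphism attached to a bijection. -/
def perm {S T : Type} [DecidableEq S] [DecidableEq T] [Fintype T] (e : S ≃ T) : Hom S T :=
  cls fun t => FreeMagma.of (e.symm t)

theorem isMultilinear_of : IsMultilinear (fun t : T => FreeMagma.of t) := by
  intro s; simp

theorem lift_of_eq (a : FreeMagma S) : FreeMagma.lift (fun s => FreeMagma.of s) a = a := by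
  induction a with
  | ih1 x => simp
  | ih2 a b iha ihb => simp [iha, ihb]

theorem id_comp [Fintype S] (x : Hom S T) : comp S S T (cls fun s => FreeMagma.of s) x = x := by
  induction x using hom_induction with
  | hadd x y hx hy => rw [map_add, hx, hy]
  | hsmul c x hx => rw [map_smul, hx]
  | hcls F hF =>
    rw [comp_cls isMultilinear_of hF]
    congr 1
    funext t
    simp [graft, lift_of_eq]
  | h0 => simp

theorem comp_id (x : Hom S T) : comp S T T x (cls fun t => FreeMagma.of t) = x := by
  induction x using hom_induction with
  | hadd x y hx hy => rw [map_add, LinearMap.add_apply, hx, hy]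
  | hsmul c x hx => rw [map_smul, LinearMap.smul_apply, hx]
  | hcls F hF =>
    rw [comp_cls hF isMultilinear_of]
    congr 1
  | h0 => simp

theorem lift_lift {R : Type} (H : S → FreeMagma R) (G : T → FreeMagma S) (a : FreeMagma T) :
    FreeMagma.lift H (FreeMagma.lift G a) = FreeMagma.lift (fun t => FreeMagma.lift H (G t)) a := by
  induction a with
  | ih1 x => simp
  | ih2 a b iha ihb => simp [iha, ihb]

theorem comp_assoc {R : Type} [DecidableEq R] [Fintype S] (x : Hom R S) (y : Hom S T)
    (z : Hom T U) : comp R T U (comp R S T x y) z = comp R S U x (comp S T U y z) := by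
  induction x using hom_induction with
  | hadd x y hx hy => simp only [map_add, LinearMap.add_apply, hx, hy]
  | hsmul c x hx => simp only [map_smul, LinearMap.smul_apply, hx]
  | h0 => simp
  | hcls H hH =>
  induction y using hom_induction with
  | hadd x y hx hy => simp only [map_add, LinearMap.add_apply, hx, hy]
  | hsmul c x hx => simp only [map_smul, LinearMap.smul_apply, hx]
  | h0 => simp
  | hcls G hG =>
  induction z using hom_induction with
  | hadd x y hx hy => simp only [map_add, hx, hy]
  | hsmul c x hx => simp only [map_smul, hx]
  | h0 => simp
  | hcls F hF =>
    rw [comp_cls hH hG, comp_cls hG hF, comp_cls (hH.graft hG) hF, comp_cls hH (hG.graft hF)]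
    congr 1
    funext u
    exact (lift_lift H G (F u)).symm

end Basic

/-! ### Adjoining a leaf -/

section Adjoin

variable {A S : Type} [DecidableEq A] [DecidableEq S] {n : ℕ}

/-- Relabel the leaves of a forest along `f` and adjoin the single leaf `x` as a last tree. -/
def adjoinForest (f : A → S) (x : S) (F : Fin n → FreeMagma A) : Fin (n + 1) → FreeMagma S :=
  Fin.snoc (α := fun _ => FreeMagma S) (fun i => FreeMagma.map f (F i)) (FreeMagma.of x)

/-- The linear extension of `adjoinForest`. -/
def adjoin (f : A → S) (x : S) : Hom A (Fin n) →ₗ[ℚ] Hom S (Fin (n + 1)) :=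
  liftHom (fun F => cls (adjoinForest f x F)) (by
    intro F t l hl
    have := cls_rel (adjoinForest f x F) t.castSucc (hl.map_hom (FreeMagma.map f))
    rw [List.map_map] at this
    rw [← this]
    congr 1
    refine List.map_congr_left fun a _ => ?_
    simp only [Function.comp_apply]
    congr 1
    rw [adjoinForest, adjoinForest, ← Fin.snoc_update]
    congr 1
    funext i
    by_cases h : i = t
    · subst h; simp
    · simp [h])

end Adjoin

/-- The functor `- ⊞ 1` on morphisms. -/
def boxOne (m n : ℕ) : Hom (Fin m) (Fin n) →ₗ[ℚ] Hom (Fin (m + 1)) (Fin (n + 1)) :=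
  adjoin Fin.castSucc (Fin.last m)

theorem occ_map_castSucc {m : ℕ} (s : Fin m) (a : FreeMagma (Fin m)) :
    occ s.castSucc (FreeMagma.map Fin.castSucc a) = occ s a := by
  induction a with
  | ih1 x => simp
  | ih2 a b iha ihb => simp [iha, ihb]

theorem occ_map_last {m : ℕ} (a : FreeMagma (Fin m)) :
    occ (Fin.last m) (FreeMagma.map Fin.castSucc a) = 0 := by
  induction a with
  | ih1 x => simp [Fin.castSucc_ne_last]
  | ih2 a b iha ihb => simp [iha, ihb]

theorem isMultilinear_boxOne {m n : ℕ} {F : Fin n → FreeMagma (Fin m)} (hF : IsMultilinear F) :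
    IsMultilinear (adjoinForest Fin.castSucc (Fin.last m) F) := by
  intro s
  rw [Fin.sum_univ_castSucc]
  simp only [adjoinForest, Fin.snoc_castSucc, Fin.snoc_last, occ_of]
  induction s using Fin.lastCases with
  | last => simp [occ_map_last]
  | cast s =>
    simp only [occ_map_castSucc, hF s]
    simp [(Fin.castSucc_ne_last s).symm]

theorem boxOne_cls {m n : ℕ} {F : Fin n → FreeMagma (Fin m)} (hF : IsMultilinear F) :
    boxOne m n (cls F) = cls (adjoinForest Fin.castSucc (Fin.last m) F) := by
  simp [boxOne, adjoin, hF]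

theorem boxOne_id (m : ℕ) :
    boxOne m m (cls fun i => FreeMagma.of i) = cls fun i => FreeMagma.of i := by
  rw [boxOne_cls isMultilinear_of]
  congr 1
  funext i
  induction i using Fin.lastCases with
  | last => simp [adjoinForest]
  | cast i => simp [adjoinForest]

theorem boxOne_comp {l m n : ℕ} (x : Hom (Fin l) (Fin m)) (y : Hom (Fin m) (Fin n)) :
    boxOne l n (comp _ _ _ x y) = comp _ _ _ (boxOne l m x) (boxOne m n y) := by
  induction x using hom_induction with
  | hadd x y hx hy => simp only [map_add, LinearMap.add_apply, hx, hy]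
  | hsmul c x hx => simp only [map_smul, LinearMap.smul_apply, hx]
  | h0 => simp
  | hcls G hG =>
  induction y using hom_induction with
  | hadd x y hx hy => simp only [map_add, hx, hy]
  | hsmul c x hx => simp only [map_smul, hx]
  | h0 => simp
  | hcls F hF =>
    rw [comp_cls hG hF, boxOne_cls (hG.graft hF), boxOne_cls hG, boxOne_cls hF,
      comp_cls (isMultilinear_boxOne hG) (isMultilinear_boxOne hF)]
    congr 1
    funext i
    induction i using Fin.lastCases with
    | last => simp [adjoinForest, graft]
    | cast i =>
      simp only [adjoinForest, graft, Fin.snoc_castSucc]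
      induction F i with
      | ih1 x => simp
      | ih2 a b iha ihb => simp [iha, ihb]

/-! ### The projection `π` -/

section Projection

variable {S : Type} [DecidableEq S]

/-- The image of a tree in the associative operad: the bracket is sent to the commutator. Words
are elements of the free monoid. -/
def toAss {S : Type} : FreeMagma S → MonoidAlgebra ℚ (FreeMonoid S)
  | FreeMagma.of x => MonoidAlgebra.of ℚ (FreeMonoid S) (FreeMonoid.of x)
  | FreeMagma.mul a b => toAss a * toAss b - toAss b * toAss a

/-- The operadic splitting `Ass ≅ Assᵘ ⊙ I` splits a word as `x₁ ⋯ xₖ x`, with last letter `x`.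
The letters `x₁, …, xₖ` act successively, from the right, on the forest `G`; the letter `y` acts by
the adjoint action `G ↦ ∑ᵢ (G₁, …, [Gᵢ, y], …, Gₙ)`, that is by composition with `μ(n)`. The last
letter `x` is then adjoined as a last tree. -/
def actWord {n : ℕ} : (Fin n → FreeMagma S) → List S → Hom S (Fin (n + 1))
  | _, [] => 0
  | G, [x] => cls (Fin.snoc (α := fun _ => FreeMagma S) G (FreeMagma.of x))
  | G, y :: z :: w =>
    ∑ i, actWord (Function.update G i (G i * FreeMagma.of y)) (z :: w)

/-- `actWord`, extended linearly to the associative algebra. -/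
def actAss {n : ℕ} (G : Fin n → FreeMagma S) :
    MonoidAlgebra ℚ (FreeMonoid S) →ₗ[ℚ] Hom S (Fin (n + 1)) :=
  Finsupp.linearCombination ℚ (fun w : FreeMonoid S => actWord G w.toList) ∘ₗ
    (MonoidAlgebra.coeffLinearEquiv ℚ).toLinearMap

theorem sum_map_sum {ι α M : Type} [Fintype ι] [AddCommMonoid M] (l : List α) (f : α → ι → M) :
    (l.map fun a => ∑ i, f a i).sum = ∑ i, (l.map fun a => f a i).sum := by
  induction l with
  | nil => simp
  | cons a l ih => simp [ih, Finset.sum_add_distrib]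

theorem actWord_rel {n : ℕ} (w : List S) : ∀ (G : Fin n → FreeMagma S) (t : Fin n)
    (l : List (FreeMagma S)), TreeRel l →
    (l.map fun a => actWord (Function.update G t a) w).sum = 0 := by
  induction w with
  | nil => intro G t l _; simp [actWord]
  | cons y w ih =>
    intro G t l hl
    cases w with
    | nil =>
      simp only [actWord, Fin.snoc_update]
      exact cls_rel _ _ hl
    | cons z w =>
      simp only [actWord]
      rw [sum_map_sum]
      refine Finset.sum_eq_zero fun i _ => ?_
      by_cases h : i = t
      · subst h
        have := ih G i _ (hl.left (FreeMagma.of y))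
        rw [List.map_map] at this
        simpa [Function.comp_def] using this
      · simp only [Function.update_of_ne h, Function.update_comm (Ne.symm h)]
        exact ih _ _ _ hl

theorem toAss_mul {S : Type} (a b : FreeMagma S) :
    toAss (a * b) = toAss a * toAss b - toAss b * toAss a := rfl

theorem toAss_rel {S : Type} {l : List (FreeMagma S)} (hl : TreeRel l) :
    (l.map toAss).sum = 0 := by
  have key : ∀ (l : List (FreeMagma S)) (c : FreeMagma S),
      (l.map fun a => toAss (a * c)).sum
        = (l.map toAss).sum * toAss c - toAss c * (l.map toAss).sum ∧
      (l.map fun a => toAss (c * a)).sum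
        = toAss c * (l.map toAss).sum - (l.map toAss).sum * toAss c := by
    intro l c
    induction l with
    | nil => simp
    | cons a l ih =>
      simp only [List.map_cons, List.sum_cons]
      rw [ih.1, ih.2, toAss_mul, toAss_mul]
      constructor <;> noncomm_ring
  induction hl with
  | anti a b => simp [toAss_mul]
  | jacobi a b c =>
    simp only [List.map_cons, List.map_nil, List.sum_cons, List.sum_nil, toAss_mul]
    noncomm_ring
  | @left l c _ ih =>
    rw [List.map_map, Function.comp_def, (key l c).1, ih]
    simp
  | @right l c _ ih =>
    rw [List.map_map, Function.comp_def, (key l c).2, ih]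
    simp

theorem actAss_rel {n : ℕ} (G : Fin n → FreeMagma S) (t : Fin n)
    {l : List (FreeMagma S)} (hl : TreeRel l) (p : MonoidAlgebra ℚ (FreeMonoid S)) :
    (l.map fun a => actAss (Function.update G t a) p).sum = 0 := by
  simp only [actAss, LinearMap.comp_apply]
  generalize (MonoidAlgebra.coeffLinearEquiv ℚ).toLinearMap p = q
  induction q using Finsupp.induction_linear with
  | zero => simp
  | add f g hf hg => simp only [map_add, List.sum_map_add, hf, hg, add_zero]
  | single w c =>
    simp only [Finsupp.linearCombination_single]
    have := congrArg (fun z => c • z) (actWord_rel w.toList G t l hl)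
    simpa [List.smul_sum, Function.comp_def] using this

/-- The map `π` as an endomorphism of `Hom S (n + 1)`: the last tree of a forest is
expanded in the associative operad, and the result acts on the first `n` trees by `actAss`. -/
def projAux (S : Type) [DecidableEq S] (n : ℕ) :
    Hom S (Fin (n + 1)) →ₗ[ℚ] Hom S (Fin (n + 1)) :=
  liftHom (fun F => actAss (Fin.init (α := fun _ => FreeMagma S) F) (toAss (F (Fin.last n)))) (by
    intro F t l hl
    induction t using Fin.lastCases with
    | last =>
      simp only [Fin.init_update_last, Function.update_self]
      have := congrArg (actAss (Fin.init (α := fun _ => FreeMagma S) F)) (toAss_rel hl)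
      rw [map_list_sum, List.map_map, map_zero] at this
      exact this
    | cast t =>
      simp only [Fin.init_update_castSucc, ne_eq, (Fin.castSucc_ne_last t).symm,
        not_false_eq_true, Function.update_of_ne]
      exact actAss_rel _ _ hl _)

/-- The subspace of `Hom S (n + 1)` spanned by the forests whose last tree is a single leaf,
that is the sum of the terms indexed by the surjections `f` with `|f⁻¹ (n + 1)| = 1`. -/
def lastLeaf (S : Type) [DecidableEq S] (n : ℕ) : Submodule ℚ (Hom S (Fin (n + 1))) :=
  Submodule.span ℚ {z | ∃ (F : Fin (n + 1) → FreeMagma S) (x : S),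
    IsMultilinear F ∧ F (Fin.last n) = FreeMagma.of x ∧ z = cls F}

theorem actWord_mem {n : ℕ} (w : List S) : ∀ G : Fin n → FreeMagma S,
    actWord G w ∈ lastLeaf S n := by
  induction w with
  | nil => intro G; exact zero_mem _
  | cons y w ih =>
    intro G
    cases w with
    | nil =>
      rw [actWord]
      by_cases h : IsMultilinear (Fin.snoc (α := fun _ => FreeMagma S) G (FreeMagma.of y))
      · exact Submodule.subset_span ⟨_, y, h, by simp, rfl⟩
      · rw [cls_of_not h]
        exact zero_mem _
    | cons z w => exact Submodule.sum_mem _ fun i _ => ih _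

theorem projAux_mem {n : ℕ} (z : Hom S (Fin (n + 1))) : projAux S n z ∈ lastLeaf S n := by
  induction z using hom_induction with
  | hadd x y hx hy => rw [map_add]; exact add_mem hx hy
  | hsmul c x hx => rw [map_smul]; exact Submodule.smul_mem _ _ hx
  | h0 => rw [map_zero]; exact zero_mem _
  | hcls F hF =>
    rw [projAux, liftHom_cls _ _ hF, actAss, LinearMap.comp_apply,
      Finsupp.linearCombination_apply]
    exact Submodule.sum_mem _ fun w _ => Submodule.smul_mem _ _ (actWord_mem _ _)

/-- The element `μ(n)`: the sum over `i` of the forests in which the letter `n + 1` is bracketed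
with the `i`th letter, from the right. -/
def mu (n : ℕ) : Hom (Fin (n + 1)) (Fin n) :=
  ∑ i : Fin n, cls (Function.update (fun j : Fin n => FreeMagma.of j.castSucc) i
    (FreeMagma.of i.castSucc * FreeMagma.of (Fin.last n)))

theorem isMultilinear_mu {n : ℕ} (i : Fin n) :
    IsMultilinear (Function.update (fun j : Fin n => FreeMagma.of j.castSucc) i
      (FreeMagma.of i.castSucc * FreeMagma.of (Fin.last n))) := by
  intro s
  rw [← Finset.add_sum_erase _ _ (Finset.mem_univ i)]
  have h : ∀ j ∈ Finset.univ.erase i, occ s (Function.update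
      (fun j : Fin n => FreeMagma.of j.castSucc) i
      (FreeMagma.of i.castSucc * FreeMagma.of (Fin.last n)) j)
        = if j.castSucc = s then 1 else 0 := by
    intro j hj
    simp [Finset.ne_of_mem_erase hj]
  rw [Finset.sum_congr rfl h, Function.update_self, occ_mul, occ_of, occ_of, add_right_comm,
    Finset.add_sum_erase _ (fun j : Fin n => if j.castSucc = s then 1 else 0) (Finset.mem_univ i)]
  induction s using Fin.lastCases with
  | last => simp [Fin.castSucc_ne_last]
  | cast s => simp [(Fin.castSucc_ne_last s).symm]

/-- The action of a letter used in `actWord` is the composition with `μ(n)`. -/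
theorem comp_mu {n : ℕ} (G : Fin n → FreeMagma S) (x : S)
    (h : IsMultilinear (Fin.snoc (α := fun _ => FreeMagma S) G (FreeMagma.of x))) :
    comp _ _ _ (cls (Fin.snoc (α := fun _ => FreeMagma S) G (FreeMagma.of x))) (mu n) =
      ∑ i, cls (Function.update G i (G i * FreeMagma.of x)) := by
  rw [mu, map_sum]
  refine Finset.sum_congr rfl fun i _ => ?_
  rw [comp_cls h (isMultilinear_mu i)]
  congr 1
  funext j
  by_cases hj : j = i
  · subst hj; simp [graft]
  · simp [graft, hj]

end Projection

/-! ### The convolution product with the unit operad `I` -/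

section Convolution

/-- The unit operad `I`: it is `ℚ` on one-point sets and `0` on all other finite sets. -/
abbrev UnitOperad (S : Type) : Type := {x : S // ∀ y, y = x} →₀ ℚ

/-- The action of bijections on `I`. -/
def UnitOperad.relabel {S S' : Type} (e : S' ≃ S) : UnitOperad S →ₗ[ℚ] UnitOperad S' :=
  Finsupp.lmapDomain ℚ ℚ fun x => ⟨e.symm x.1, fun y => by rw [← x.2 (e y), e.symm_apply_apply]⟩

variable {S S' : Type} [DecidableEq S] [Fintype S] [DecidableEq S'] [Fintype S'] {n n' : ℕ}

/-- The value at `S` of the convolution product of the right module `Hom - n` with `I`: the sum of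
`Hom A n ⊗ I (S \ A)` over the subsets `A` of `S`. -/
abbrev ConvUnit (S : Type) [DecidableEq S] [Fintype S] (n : ℕ) : Type :=
  DirectSum (Finset S) fun A =>
    TensorProduct ℚ (Hom {x // x ∈ A} (Fin n)) (UnitOperad {x // ¬ x ∈ A})

/-- The left action on the convolution product, through the first factor. -/
def ConvUnit.left (φ : Hom (Fin n) (Fin n')) : ConvUnit S n →ₗ[ℚ] ConvUnit S n' :=
  DirectSum.toModule ℚ _ _ fun A =>
    DirectSum.lof ℚ _ (fun A : Finset S =>
      TensorProduct ℚ (Hom {x // x ∈ A} (Fin n')) (UnitOperad {x // ¬ x ∈ A})) A ∘ₗ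
    TensorProduct.map ((comp _ _ _).flip φ) LinearMap.id

/-- The right action of bijections on the convolution product. -/
def ConvUnit.right (e : S' ≃ S) : ConvUnit S n →ₗ[ℚ] ConvUnit S' n :=
  DirectSum.toModule ℚ _ _ fun A =>
    DirectSum.lof ℚ _ (fun A : Finset S' =>
      TensorProduct ℚ (Hom {x // x ∈ A} (Fin n)) (UnitOperad {x // ¬ x ∈ A}))
      (A.map e.symm.toEmbedding) ∘ₗ
    TensorProduct.map
      (comp _ _ _ (perm (e.subtypeEquiv (by simp))))
      (UnitOperad.relabel (e.subtypeEquiv (by simp)))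

/-- The map from the convolution product to `Hom S (n + 1)` that adjoins the leaf given by
the second tensor factor as a last tree. -/
def convIncl (S : Type) [DecidableEq S] [Fintype S] (n : ℕ) :
    ConvUnit S n →ₗ[ℚ] Hom S (Fin (n + 1)) :=
  DirectSum.toModule ℚ _ _ fun A => TensorProduct.lift
    (Finsupp.linearCombination ℚ fun x : {x : {x // ¬ x ∈ A} // ∀ y, y = x} =>
      adjoin (n := n) (Subtype.val : {x // x ∈ A} → S) x.1.1).flip

end Convolution

end LieForest

/-! ### The category and its bimodules -/

/-- The `ℚ`-linear category associated to the Lie operad; its objects are the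
natural numbers. -/
@[ext]
structure CatLie where
  /-- the natural number -/
  arity : ℕ

namespace CatLie

open LieForest

instance : Category.{0} CatLie where
  Hom m n := LieForest.Hom (Fin m.arity) (Fin n.arity)
  id m := cls fun i => FreeMagma.of i
  comp φ ψ := comp _ _ _ φ ψ
  id_comp φ := id_comp φ
  comp_id φ := comp_id φ
  assoc φ ψ χ := comp_assoc φ ψ χ

instance : Preadditive CatLie where
  homGroup m n := inferInstanceAs (AddCommGroup (LieForest.Hom (Fin m.arity) (Fin n.arity)))
  add_comp l m n φ φ' ψ :=
    LinearMap.map_add₂ (comp (Fin l.arity) (Fin m.arity) (Fin n.arity)) φ φ' ψ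
  comp_add l m n φ ψ ψ' :=
    (comp (Fin l.arity) (Fin m.arity) (Fin n.arity) φ).map_add ψ ψ'

instance : Linear ℚ CatLie where
  homModule m n := inferInstanceAs (Module ℚ (LieForest.Hom (Fin m.arity) (Fin n.arity)))
  smul_comp l m n c φ ψ :=
    LinearMap.map_smul₂ (comp (Fin l.arity) (Fin m.arity) (Fin n.arity)) c φ ψ
  comp_smul l m n φ c ψ :=
    (comp (Fin l.arity) (Fin m.arity) (Fin n.arity) φ).map_smul c ψ

/-- The functor `- ⊞ 1`. -/
def shift : CatLie ⥤ CatLie where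
  obj n := ⟨n.arity + 1⟩
  map φ := boxOne _ _ φ
  map_id m := boxOne_id m.arity
  map_comp φ ψ := boxOne_comp φ ψ

instance : shift.Additive where
  map_add {m n} φ ψ := map_add (boxOne m.arity n.arity) φ ψ

instance : shift.Linear ℚ where
  map_smul {m n} φ c := map_smul (boxOne m.arity n.arity) c φ

/-- The bimodule `δ CatLie`, with `δ CatLie (m, n) = CatLie (m, n + 1)`. -/
def delta : LinearBimodule CatLie (fun m n : CatLie => (m ⟶ shift.obj n)) :=
  (LinearBimodule.regular CatLie).pullLeft shift

/-- The subspace `δ⁽¹⁾ CatLie (m, n)` of `δ CatLie (m, n)`. -/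
def deltaOne (m n : CatLie) : Submodule ℚ (m ⟶ shift.obj n) :=
  lastLeaf (Fin m.arity) n.arity

/-- The map `π : δ CatLie → δ⁽¹⁾ CatLie`. -/
def proj (m n : CatLie) : (m ⟶ shift.obj n) →ₗ[ℚ] deltaOne m n :=
  (projAux (Fin m.arity) n.arity).codRestrict (lastLeaf (Fin m.arity) n.arity) projAux_mem

/-- `CatLie ⊙ I`. -/
abbrev ConvI (m n : CatLie) : Type := ConvUnit (Fin m.arity) n.arity

/-- The map `CatLie ⊙ I → δ CatLie` induced by the unit `I → Lie`. -/
def inclI (m n : CatLie) : ConvI m n →ₗ[ℚ] (m ⟶ shift.obj n) :=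
  convIncl (Fin m.arity) n.arity

/-- The morphism of `CatLie` given by a permutation. -/
def ofPerm {m : CatLie} (σ : Equiv.Perm (Fin m.arity)) : m ⟶ m := perm σ

end CatLie

end

/-! Since `π` is a retraction onto `δ⁽¹⁾`, a bimodule structure on `δ⁽¹⁾` making `π` a morphism
exists exactly when `ker π` is stable under both actions. It is then forced: each `z` in `δ⁽¹⁾`
equals `π z`, so acting on `z` must mean acting in `δ` and applying `π`. Two identities carry the
proof.

Left action (`projAux_comp_boxOne`): `φ ⊞ 1` does not touch the last tree, so it suffices that the
adjoint action of a letter commutes with grafting. This is the Jacobi identity read as a derivation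
rule: bracketing an iterated bracket with `y` is the sum over its leaves of bracketing that leaf
with `y` (`RespectsRel.lift_mul`, `sum_update_graft`).

Right action (`projAux_comp_projAux`): precomposition substitutes trees for letters, and
substitution commutes with the expansion in the associative algebra (`toAss_lift`). It remains to
see that a tree acts in the same way by bracketing and through its associative expansion
(`actAss_toAss_mul`); this is the extension of a Lie action to the enveloping algebra. The last
letter of a word does not act but becomes a leaf, so this is stated for products whose right factor
lies in the span of the nonempty words.

The comparison with `CatLie ⊙ I` is independent of this. As `I` lives on one-point sets, only
complements of single letters contribute. Reading off the last leaf gives a left inverse of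
`convIncl`; it is well defined because a bare leaf occurs in no relation. -/

noncomputable section

namespace LieForest

/-! ### Bracketing on the right as a derivation -/

section Derivation

set_option linter.unusedSectionVars false

variable {S T U M : Type} [DecidableEq S] [AddCommGroup M]

/-- A function on trees that is compatible with antisymmetry and the Jacobi identity. -/
def RespectsRel (f : FreeMagma S → M) : Prop :=
  ∀ l : List (FreeMagma S), TreeRel l → (l.map f).sum = 0

/-- Relations may be applied at any vertex, so bracketing with a fixed tree preserves them. This
lets inductions on trees descend into one factor while the other is absorbed into `f`. -/
theorem RespectsRel.mul_right {f : FreeMagma S → M} (hf : RespectsRel f) (c : FreeMagma S) :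
    RespectsRel fun a => f (a * c) := fun l hl => by
  have := hf _ (hl.left c)
  rwa [List.map_map] at this

theorem RespectsRel.mul_left {f : FreeMagma S → M} (hf : RespectsRel f) (c : FreeMagma S) :
    RespectsRel fun a => f (c * a) := fun l hl => by
  have := hf _ (hl.right c)
  rwa [List.map_map] at this

/-- The Jacobi identity as a derivation rule for right brackets. -/
theorem RespectsRel.mul_mul {f : FreeMagma S → M} (hf : RespectsRel f) (a b c : FreeMagma S) :
    f (a * b * c) = f (a * c * b) + f (a * (b * c)) := by
  -- The cyclic Jacobi relation, with the antisymmetries needed to rewrite its terms in the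
  -- derivation form.
  have h1 := hf _ (TreeRel.jacobi a b c)
  have h2 := hf _ (TreeRel.anti (a * b) c)
  have h3 := hf _ (TreeRel.anti (a * c) b)
  have h4 := hf _ ((TreeRel.anti c a).right b)
  simp only [List.map_cons, List.map_nil, List.sum_cons, List.sum_nil, add_zero] at h1 h2 h3 h4
  rw [eq_neg_of_add_eq_zero_left h2, eq_neg_of_add_eq_zero_left h3]
  rw [eq_neg_of_add_eq_zero_left h4] at h1
  have h5 : f (a * (b * c)) = f (b * (a * c)) - f (c * (a * b)) := by
    rw [← sub_eq_zero, ← h1]; abel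
  rw [h5]; abel

variable [DecidableEq T] [Fintype T]

/-- The right bracket by `y` is a derivation of an iterated bracket `b`. -/
theorem RespectsRel.lift_mul {f : FreeMagma S → M} (hf : RespectsRel f) (G : T → FreeMagma S)
    (y : FreeMagma S) (b : FreeMagma T) (hb : ∀ t, occ t b ≤ 1) :
    f (FreeMagma.lift G b * y) =
      ∑ t, occ t b • f (FreeMagma.lift (Function.update G t (G t * y)) b) := by
  induction b generalizing f with
  | ih1 x => simp [ite_smul]
  | ih2 b c ihb ihc =>
    simp only [occ_mul] at hb
    -- `[[b, c], y] = [[b, y], c] + [b, [c, y]]`; the induction hypotheses are used for `f`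
    -- precomposed with the bracket by the other factor.
    rw [map_mul, hf.mul_mul, ihb (hf.mul_right _) fun t => by have := hb t; omega,
      ihc (hf.mul_left _) fun t => by have := hb t; omega, ← Finset.sum_add_distrib]
    refine Finset.sum_congr rfl fun t _ => ?_
    rw [occ_mul, add_smul, map_mul]
    congr 1
    -- A letter occurring in one factor is absent from the other, so changing `G` at that letter
    -- leaves the other factor alone.
    · by_cases h : occ t b = 0
      · simp [h]
      · rw [lift_update_of_occ_zero G t _ c (by have := hb t; omega)]
    · by_cases h : occ t c = 0
      · simp [h]
      · rw [lift_update_of_occ_zero G t _ b (by have := hb t; omega)]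

variable [DecidableEq U] [Fintype U]

theorem occ_le_one {F : U → FreeMagma T} (hF : IsMultilinear F) (t : T) (u : U) :
    occ t (F u) ≤ 1 :=
  hF t ▸ Finset.single_le_sum (f := fun u => occ t (F u)) (fun _ _ => Nat.zero_le _)
    (Finset.mem_univ u)

/-- The right bracket by `y` commutes with the grafting on a multilinear forest. -/
theorem sum_update_graft {f : (U → FreeMagma S) → M}
    (hf : ∀ F u, RespectsRel fun a => f (Function.update F u a))
    (G : T → FreeMagma S) {F : U → FreeMagma T} (hF : IsMultilinear F) (y : FreeMagma S) :
    ∑ u, f (Function.update (graft G F) u (graft G F u * y)) =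
      ∑ t, f (graft (Function.update G t (G t * y)) F) := by
  -- The weight is nonzero only when `F u` is the tree containing `t`; then changing `G t` affects
  -- no other tree of the grafted forest.
  have key : ∀ t u, occ t (F u) • f (Function.update (graft G F) u
      (FreeMagma.lift (Function.update G t (G t * y)) (F u))) =
        occ t (F u) • f (graft (Function.update G t (G t * y)) F) := by
    intro t u
    by_cases h : occ t (F u) = 0
    · simp [h]
    congr 2
    funext v
    by_cases hv : v = u
    · subst hv; simp [graft]
    rw [Function.update_of_ne hv, graft, graft, lift_update_of_occ_zero]
    have h2 : occ t (F v) + occ t (F u) ≤ ∑ w, occ t (F w) := by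
      rw [← Finset.sum_pair (f := fun w => occ t (F w)) hv]
      exact Finset.sum_le_sum_of_subset (Finset.subset_univ _)
    have := hF t
    omega
  calc
    _ = ∑ u, ∑ t, occ t (F u) • f (graft (Function.update G t (G t * y)) F) := by
      refine Finset.sum_congr rfl fun u _ => ?_
      rw [graft, (hf (graft G F) u).lift_mul G y (F u) fun t => occ_le_one hF t u]
      exact Finset.sum_congr rfl fun t _ => key t u
    _ = _ := by
      rw [Finset.sum_comm]
      refine Finset.sum_congr rfl fun t _ => ?_
      rw [← Finset.sum_smul, hF t, one_smul]

end Derivation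

/-! ### The projection and the left action -/

section Projection

set_option linter.unusedSectionVars false

variable {S T : Type} [DecidableEq S]

theorem respectsRel_actWord {n : ℕ} (w : List S) (G : Fin n → FreeMagma S) (i : Fin n) :
    RespectsRel fun a => actWord (Function.update G i a) w :=
  actWord_rel w G i

theorem respectsRel_actAss {n : ℕ} (p : MonoidAlgebra ℚ (FreeMonoid S)) (G : Fin n → FreeMagma S)
    (i : Fin n) : RespectsRel fun a => actAss (Function.update G i a) p :=
  fun _ hl => actAss_rel G i hl p

theorem actAss_of {n : ℕ} (G : Fin n → FreeMagma S) (w : FreeMonoid S) :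
    actAss G (MonoidAlgebra.of ℚ _ w) = actWord G w.toList := by
  simp [actAss, MonoidAlgebra.of_apply]

/-- The first letter acts by the bracket only if another letter follows; a final letter is adjoined
as a leaf instead. This is why nonempty words are singled out below. -/
theorem actWord_cons {n : ℕ} (G : Fin n → FreeMagma S) (y : S) {w : List S} (hw : w ≠ []) :
    actWord G (y :: w) = ∑ i, actWord (Function.update G i (G i * FreeMagma.of y)) w := by
  cases w with
  | nil => exact absurd rfl hw
  | cons z w => rfl

/-- The augmentation ideal, spanned by the nonempty words. -/
def augmentation (S : Type) : Submodule ℚ (MonoidAlgebra ℚ (FreeMonoid S)) :=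
  Submodule.span ℚ {p | ∃ w : FreeMonoid S, w.toList ≠ [] ∧ p = MonoidAlgebra.of ℚ _ w}

/-- Prepending letters to a nonempty word keeps it nonempty, so only the right factor matters. -/
theorem mul_mem_augmentation {p q : MonoidAlgebra ℚ (FreeMonoid S)} (hq : q ∈ augmentation S) :
    p * q ∈ augmentation S := by
  induction hq using Submodule.span_induction with
  | zero => simp
  | add x y _ _ hx hy => rw [mul_add]; exact add_mem hx hy
  | smul c x _ hx => rw [mul_smul_comm]; exact Submodule.smul_mem _ _ hx
  | mem x hx =>
    obtain ⟨w, hw, rfl⟩ := hx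
    induction p using MonoidAlgebra.induction_on with
    | of v =>
      rw [← map_mul]
      exact Submodule.subset_span ⟨_, by simp [hw], rfl⟩
    | add x y hx hy => rw [add_mul]; exact add_mem hx hy
    | smul c x hx => rw [smul_mul_assoc]; exact Submodule.smul_mem _ _ hx

theorem toAss_mem_augmentation (a : FreeMagma S) : toAss a ∈ augmentation S := by
  induction a with
  | ih1 x => exact Submodule.subset_span ⟨FreeMonoid.of x, by simp, rfl⟩
  | ih2 a b iha ihb =>
    rw [toAss_mul]
    exact sub_mem (mul_mem_augmentation ihb) (mul_mem_augmentation iha)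

theorem actAss_of_mul {n : ℕ} (G : Fin n → FreeMagma S) (y : S)
    {q : MonoidAlgebra ℚ (FreeMonoid S)} (hq : q ∈ augmentation S) :
    actAss G (MonoidAlgebra.of ℚ _ (FreeMonoid.of y) * q) =
      ∑ i, actAss (Function.update G i (G i * FreeMagma.of y)) q := by
  induction hq using Submodule.span_induction with
  | zero => simp
  | add x y _ _ hx hy => simp only [mul_add, map_add, hx, hy, Finset.sum_add_distrib]
  | smul c x _ hx => simp only [mul_smul_comm, map_smul, hx, Finset.smul_sum]
  | mem x hx =>
    obtain ⟨w, hw, rfl⟩ := hx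
    rw [← map_mul, actAss_of]
    simp only [actAss_of]
    exact actWord_cons G y hw

/-- A Lie element acts through the associative algebra by the bracket. -/
theorem actAss_toAss_mul {n : ℕ} (a : FreeMagma S) (G : Fin n → FreeMagma S)
    {q : MonoidAlgebra ℚ (FreeMonoid S)} (hq : q ∈ augmentation S) :
    actAss G (toAss a * q) = ∑ i, actAss (Function.update G i (G i * a)) q := by
  induction a generalizing G q with
  | ih1 x => exact actAss_of_mul G x hq
  | ih2 a b iha ihb =>
    rw [toAss_mul, sub_mul, mul_assoc, mul_assoc, map_sub, iha _ (mul_mem_augmentation hq),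
      ihb _ (mul_mem_augmentation hq), Finset.sum_congr rfl fun i _ => ihb _ hq,
      Finset.sum_congr (g := fun i => ∑ j, _) rfl fun i _ => iha
        (Function.update G i (G i * b)) hq]
    -- After exchanging the second double sum, terms with the same pair of positions face each
    -- other. Off the diagonal they cancel, as operations on different trees commute; on the
    -- diagonal Jacobi turns `[[Gᵢ, a], b] - [[Gᵢ, b], a]` into `[Gᵢ, [a, b]]`.
    nth_rw 2 [Finset.sum_comm]
    rw [← Finset.sum_sub_distrib]
    refine Finset.sum_congr rfl fun i _ => ?_
    rw [← Finset.sum_sub_distrib, Finset.sum_eq_single i]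
    · simp only [Function.update_self, Function.update_idem]
      rw [(respectsRel_actAss q G i).mul_mul, add_sub_cancel_left]
    · intro j _ hj
      rw [Function.update_of_ne hj, Function.update_of_ne hj.symm, Function.update_comm hj,
        sub_self]
    · simp

theorem projAux_cls {n : ℕ} {F : Fin (n + 1) → FreeMagma S} (hF : IsMultilinear F) :
    projAux S n (cls F) =
      actAss (Fin.init (α := fun _ => FreeMagma S) F) (toAss (F (Fin.last n))) :=
  liftHom_cls _ _ hF

/-- `π` is the identity on the forests whose last tree is a leaf. -/
theorem projAux_of_mem {n : ℕ} {z : Hom S (Fin (n + 1))} (hz : z ∈ lastLeaf S n) :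
    projAux S n z = z := by
  induction hz using Submodule.span_induction with
  | zero => simp
  | add x y _ _ hx hy => rw [map_add, hx, hy]
  | smul c x _ hx => rw [map_smul, hx]
  | mem z hz =>
    obtain ⟨F, x, hF, hx, rfl⟩ := hz
    rw [projAux_cls hF, hx]
    refine (actAss_of _ _).trans ?_
    rw [FreeMonoid.toList_of, actWord, ← hx, Fin.snoc_init_self]

/-- A multilinear `F` uses each tree of `G` exactly once, so leaves are only redistributed. Here `G`
may fail to be multilinear, as happens for a forest that lacks the letter about to be adjoined. -/
theorem sum_occ_graft [DecidableEq T] [Fintype T] {U : Type} [Fintype U] (G : T → FreeMagma S)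
    {F : U → FreeMagma T} (hF : IsMultilinear F) (s : S) :
    ∑ u, occ s (graft G F u) = ∑ t, occ s (G t) := by
  simp only [graft, occ_lift]
  rw [Finset.sum_comm]
  simp only [← Finset.sum_mul, hF _, one_mul]

theorem isMultilinear_snoc {n : ℕ} {G : Fin n → FreeMagma S} {a : FreeMagma S} :
    IsMultilinear (Fin.snoc (α := fun _ => FreeMagma S) G a) ↔
      ∀ s, ∑ i, occ s (G i) + occ s a = 1 := by
  simp [IsMultilinear, Fin.sum_univ_castSucc]

theorem graft_snoc {m n : ℕ} (G : Fin m → FreeMagma S) (a : FreeMagma S)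
    (F : Fin n → FreeMagma (Fin m)) :
    graft (Fin.snoc (α := fun _ => FreeMagma S) G a)
      (adjoinForest Fin.castSucc (Fin.last m) F) =
        Fin.snoc (α := fun _ => FreeMagma S) (graft G F) a := by
  funext i
  induction i using Fin.lastCases with
  | last => simp [adjoinForest, graft]
  | cast i =>
    simp only [adjoinForest, graft, Fin.snoc_castSucc]
    induction F i with
    | ih1 x => simp
    | ih2 a b iha ihb => simp [iha, ihb]

/-- The acting letters pass through the grafting by the derivation rule `sum_update_graft`, and the
adjoined leaf is not affected by `F ⊞ 1`. -/
theorem comp_actWord {m n : ℕ} {F : Fin n → FreeMagma (Fin m)} (hF : IsMultilinear F)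
    (w : List S) (G : Fin m → FreeMagma S) :
    comp _ _ _ (actWord G w) (boxOne m n (cls F)) = actWord (graft G F) w := by
  induction w generalizing G with
  | nil => simp [actWord]
  | cons y w ih =>
    cases w with
    | nil =>
      rw [actWord, actWord, boxOne_cls hF]
      by_cases h : IsMultilinear (Fin.snoc (α := fun _ => FreeMagma S) G (FreeMagma.of y))
      · rw [comp_cls h (isMultilinear_boxOne hF), graft_snoc]
      -- Both sides vanish: grafting preserves the number of occurrences of each letter, so neither
      -- forest is multilinear.
      · rw [cls_of_not h, map_zero, LinearMap.zero_apply, cls_of_not]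
        rw [isMultilinear_snoc] at h ⊢
        simpa only [sum_occ_graft G hF] using h
    | cons z w =>
      rw [actWord, actWord, map_sum, LinearMap.sum_apply]
      simp only [ih]
      exact (sum_update_graft (f := fun G => actWord G (z :: w)) (respectsRel_actWord (z :: w)) G hF _).symm

theorem comp_actAss {m n : ℕ} {F : Fin n → FreeMagma (Fin m)} (hF : IsMultilinear F)
    (p : MonoidAlgebra ℚ (FreeMonoid S)) (G : Fin m → FreeMagma S) :
    comp _ _ _ (actAss G p) (boxOne m n (cls F)) = actAss (graft G F) p := by
  induction p using MonoidAlgebra.induction_on with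
  | of w => rw [actAss_of, actAss_of, comp_actWord hF]
  | add x y hx hy => simp only [map_add, LinearMap.add_apply, hx, hy]
  | smul c x hx => simp only [map_smul, LinearMap.smul_apply, hx]

/-- `π` is compatible with the left action. -/
theorem projAux_comp_boxOne {m n : ℕ} (z : Hom S (Fin (m + 1))) (φ : Hom (Fin m) (Fin n)) :
    projAux S n (comp _ _ _ z (boxOne m n φ)) = comp _ _ _ (projAux S m z) (boxOne m n φ) := by
  induction z using hom_induction with
  | hadd x y hx hy => simp only [map_add, LinearMap.add_apply, hx, hy]
  | hsmul c x hx => simp only [map_smul, LinearMap.smul_apply, hx]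
  | h0 => simp
  | hcls G hG =>
  induction φ using hom_induction with
  | hadd x y hx hy => simp only [map_add, hx, hy]
  | hsmul c x hx => simp only [map_smul, hx]
  | h0 => simp
  | hcls F hF =>
    rw [projAux_cls hG, comp_actAss hF, boxOne_cls hF, comp_cls hG (isMultilinear_boxOne hF),
      projAux_cls (hG.graft (isMultilinear_boxOne hF))]
    conv_lhs => rw [← Fin.snoc_init_self G, graft_snoc]
    rw [Fin.init_snoc, Fin.snoc_last]

/-! ### Substitution and the right action -/

/-- Substitution of the trees `H t` for the letters `t` in the associative algebra. -/
def substAss (H : T → FreeMagma S) :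
    MonoidAlgebra ℚ (FreeMonoid T) →ₐ[ℚ] MonoidAlgebra ℚ (FreeMonoid S) :=
  MonoidAlgebra.lift ℚ _ _ (FreeMonoid.lift fun t => toAss (H t))

theorem substAss_of (H : T → FreeMagma S) (w : FreeMonoid T) :
    substAss H (MonoidAlgebra.of ℚ _ w) = FreeMonoid.lift (fun t => toAss (H t)) w :=
  MonoidAlgebra.lift_of _ _

/-- An algebra morphism preserves commutators; this is the compatibility of `Lie → Ass` with
operadic composition. -/
theorem toAss_lift (H : T → FreeMagma S) (a : FreeMagma T) :
    toAss (FreeMagma.lift H a) = substAss H (toAss a) := by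
  induction a with
  | ih1 x => exact ((substAss_of H (FreeMonoid.of x)).trans (by simp)).symm
  | ih2 a b iha ihb => simp only [map_mul, toAss_mul, map_sub, iha, ihb]

theorem substAss_mem_augmentation (H : T → FreeMagma S) (w : FreeMonoid T)
    (hw : w.toList ≠ []) : substAss H (MonoidAlgebra.of ℚ _ w) ∈ augmentation S := by
  induction w using FreeMonoid.inductionOn' with
  | one => simp at hw
  | of_mul y w ih =>
    rw [map_mul, map_mul]
    by_cases h : w.toList = []
    · obtain rfl : w = 1 := h
      rw [map_one, map_one, mul_one, substAss_of, FreeMonoid.lift_eval_of]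
      exact toAss_mem_augmentation _
    · exact mul_mem_augmentation (ih h)

theorem graft_update (H : T → FreeMagma S) {U : Type} [DecidableEq U] (F : U → FreeMagma T)
    (u : U) (a : FreeMagma T) :
    graft H (Function.update F u a) = Function.update (graft H F) u (FreeMagma.lift H a) := by
  funext v
  by_cases h : v = u
  · subst h; simp [graft]
  · simp [graft, h]

variable [DecidableEq T] [Fintype T]

/-- The words whose letters have the multiplicities of the leaves of the tree `a`. -/
theorem toAss_mem_span (a : FreeMagma S) :
    toAss a ∈ Submodule.span ℚ {p | ∃ w : FreeMonoid S, w.toList ≠ [] ∧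
      (∀ s, w.toList.count s = occ s a) ∧ p = MonoidAlgebra.of ℚ _ w} := by
  induction a with
  | ih1 x =>
    exact Submodule.subset_span ⟨FreeMonoid.of x, by simp, fun s => by
      simp [List.count_singleton], rfl⟩
  | ih2 a b iha ihb =>
    have h1 := Submodule.mul_mem_mul iha ihb
    have h2 := Submodule.mul_mem_mul ihb iha
    rw [Submodule.span_mul_span] at h1 h2
    rw [toAss_mul]
    refine sub_mem (Submodule.span_mono ?_ h1) (Submodule.span_mono ?_ h2)
    · rintro _ ⟨_, ⟨v, hv, hv', rfl⟩, _, ⟨w, hw, hw', rfl⟩, rfl⟩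
      exact ⟨v * w, by simp [hv], fun s => by simp [hv', hw'], (map_mul _ _ _).symm⟩
    · rintro _ ⟨_, ⟨v, hv, hv', rfl⟩, _, ⟨w, hw, hw', rfl⟩, rfl⟩
      exact ⟨v * w, by simp [hv], fun s => by simp [hv', hw', add_comm], (map_mul _ _ _).symm⟩

/-- Grafting turns the bracket with a leaf `y` into the bracket with the tree `H y`, which
`actAss_toAss_mul` converts into multiplication by `toAss (H y)`. For the last letter, `π` itself
expands the tree grafted at the adjoined leaf. The condition `hG` ensures that this final forest is
multilinear, so that its composite is computed by grafting. -/
theorem projAux_comp_actWord {n : ℕ} {H : T → FreeMagma S} (hH : IsMultilinear H)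
    (w : List T) (hw : w ≠ []) (G : Fin n → FreeMagma T)
    (hG : ∀ t, ∑ i, occ t (G i) + w.count t = 1) :
    projAux S n (comp _ _ _ (cls H) (actWord G w)) =
      actAss (graft H G) (substAss H (MonoidAlgebra.of ℚ _ (FreeMonoid.ofList w))) := by
  induction w generalizing G with
  | nil => exact absurd rfl hw
  | cons y w ih =>
    cases w with
    | nil =>
      have h : IsMultilinear (Fin.snoc (α := fun _ => FreeMagma T) G (FreeMagma.of y)) := by
        rw [isMultilinear_snoc]
        simpa [List.count_singleton] using hG
      rw [actWord, comp_cls hH h, projAux_cls (hH.graft h), substAss_of]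
      congr 2
      · funext i; simp [Fin.init, graft]
      · simp [graft]
    | cons z w =>
      rw [actWord, map_sum, map_sum, FreeMonoid.ofList_cons, map_mul, map_mul]
      have hy : substAss H (MonoidAlgebra.of ℚ _ (FreeMonoid.of y)) = toAss (H y) := by
        rw [substAss_of, FreeMonoid.lift_eval_of]
      rw [hy, actAss_toAss_mul _ _ (substAss_mem_augmentation H _ (by simp))]
      refine Finset.sum_congr rfl fun i _ => ?_
      rw [ih (by simp), graft_update, map_mul, FreeMagma.lift_of, graft]
      intro t
      -- The letter `y` has moved from the word into the `i`th tree, so the total count of each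
      -- letter is unchanged.
      rw [← hG t, ← Finset.add_sum_erase _ _ (Finset.mem_univ i),
        ← Finset.add_sum_erase _ (fun j => occ t (G j)) (Finset.mem_univ i),
        Finset.sum_congr rfl fun j hj => by
          rw [Function.update_of_ne (Finset.ne_of_mem_erase hj)], List.count_cons (b := y)]
      simp
      ring

/-- The kernel of `π` is stable under the right action. -/
theorem projAux_comp_projAux {n : ℕ} (φ : Hom S T) (z : Hom T (Fin (n + 1))) :
    projAux S n (comp _ _ _ φ (projAux T n z)) = projAux S n (comp _ _ _ φ z) := by
  induction φ using hom_induction with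
  | hadd x y hx hy => simp only [map_add, LinearMap.add_apply, hx, hy]
  | hsmul c x hx => simp only [map_smul, LinearMap.smul_apply, hx]
  | h0 => simp
  | hcls H hH =>
  induction z using hom_induction with
  | hadd x y hx hy => simp only [map_add, hx, hy]
  | hsmul c x hx => simp only [map_smul, hx]
  | h0 => simp
  | hcls F hF =>
    rw [comp_cls hH hF, projAux_cls hF, projAux_cls (hH.graft hF), graft, toAss_lift]
    -- The claim is linear in the expansion, but holds word by word only for words with the same
    -- letters as the last tree: `projAux_comp_actWord` needs this multiplicity condition.
    have h : ∀ p ∈ Submodule.span ℚ {p | ∃ w : FreeMonoid T, w.toList ≠ [] ∧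
        (∀ t, w.toList.count t = occ t (F (Fin.last n))) ∧ p = MonoidAlgebra.of ℚ _ w},
        projAux S n (comp _ _ _ (cls H) (actAss (Fin.init (α := fun _ => FreeMagma T) F) p)) =
          actAss (graft H (Fin.init (α := fun _ => FreeMagma T) F)) (substAss H p) := by
      intro p hp
      induction hp using Submodule.span_induction with
      | zero => simp
      | add x y _ _ hx hy => simp only [map_add, hx, hy]
      | smul c x _ hx => simp only [map_smul, hx]
      | mem x hx =>
        obtain ⟨w, hw, hw', rfl⟩ := hx
        rw [actAss_of, projAux_comp_actWord hH _ hw, FreeMonoid.ofList_toList]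
        intro t
        rw [hw']
        exact (Fin.sum_univ_castSucc _).symm.trans (hF t)
    exact h _ (toAss_mem_span _)

end Projection

/-! ### Adjoining a leaf and the convolution product with the unit operad -/

section Convolution

set_option linter.unusedSectionVars false

variable {A S S' : Type} [DecidableEq A] [DecidableEq S] [DecidableEq S'] {m n : ℕ}

theorem occ_map {f : A → S} (hf : Function.Injective f) (s : A) (a : FreeMagma A) :
    occ (f s) (FreeMagma.map f a) = occ s a := by
  induction a with
  | ih1 x => simp [hf.eq_iff]
  | ih2 a b iha ihb => simp [iha, ihb]

theorem occ_map_of_notMem {f : A → S} {s : S} (hs : s ∉ Set.range f) (a : FreeMagma A) :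
    occ s (FreeMagma.map f a) = 0 := by
  induction a with
  | ih1 x => simpa using fun h => hs ⟨x, h⟩
  | ih2 a b iha ihb => simp [iha, ihb]

theorem lift_map {R S T : Type} (H : S → FreeMagma T) (f : R → S) (a : FreeMagma R) :
    FreeMagma.lift H (FreeMagma.map f a) = FreeMagma.lift (fun x => H (f x)) a := by
  induction a with
  | ih1 x => simp
  | ih2 a b iha ihb => simp [iha, ihb]

theorem map_lift {R S T : Type} (f : S → T) (H : R → FreeMagma S) (a : FreeMagma R) :
    FreeMagma.map f (FreeMagma.lift H a) = FreeMagma.lift (fun x => FreeMagma.map f (H x)) a := by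
  induction a with
  | ih1 x => simp
  | ih2 a b iha ihb => simp [iha, ihb]

theorem map_map_of_leftInverse {f : A → S} {g : S → A} (h : Function.LeftInverse g f)
    (a : FreeMagma A) : FreeMagma.map g (FreeMagma.map f a) = a := by
  induction a with
  | ih1 x => simp [h x]
  | ih2 a b iha ihb => simp [iha, ihb]

/-- Adjoining `x` to a forest relabelled along `f` gives a multilinear forest, when the values of
`f` are exactly the letters other than `x`. -/
theorem isMultilinear_adjoinForest {f : A → S} (hf : Function.Injective f) {x : S}
    (hx : ∀ s, s ∈ Set.range f ↔ s ≠ x) {F : Fin n → FreeMagma A} :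
    IsMultilinear (adjoinForest f x F) ↔ IsMultilinear F := by
  rw [adjoinForest, isMultilinear_snoc]
  constructor
  · intro h a
    have hne : x ≠ f a := ((hx (f a)).1 ⟨a, rfl⟩).symm
    simpa [occ_map hf, hne] using h (f a)
  · intro h s
    by_cases hs : s ∈ Set.range f
    · obtain ⟨a, rfl⟩ := hs
      have hne : x ≠ f a := ((hx (f a)).1 ⟨a, rfl⟩).symm
      simpa [occ_map hf, hne] using h a
    · obtain rfl : s = x := not_not.1 (mt (hx s).2 hs)
      simp [occ_map_of_notMem hs]

theorem adjoin_cls (f : A → S) (x : S) {F : Fin n → FreeMagma A} (hF : IsMultilinear F) :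
    adjoin f x (cls F) = cls (adjoinForest f x F) :=
  liftHom_cls _ _ hF

theorem adjoin_comp {f : A → S} (hf : Function.Injective f) {x : S}
    (hx : ∀ s, s ∈ Set.range f ↔ s ≠ x) (y : Hom A (Fin m)) (φ : Hom (Fin m) (Fin n)) :
    adjoin f x (comp _ _ _ y φ) = comp _ _ _ (adjoin f x y) (boxOne m n φ) := by
  induction y using hom_induction with
  | hadd x y hx hy => simp only [map_add, LinearMap.add_apply, hx, hy]
  | hsmul c x hx => simp only [map_smul, LinearMap.smul_apply, hx]
  | h0 => simp
  | hcls G hG =>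
  induction φ using hom_induction with
  | hadd x y hx hy => simp only [map_add, hx, hy]
  | hsmul c x hx => simp only [map_smul, hx]
  | h0 => simp
  | hcls F hF =>
    rw [comp_cls hG hF, adjoin_cls _ _ (hG.graft hF), adjoin_cls _ _ hG, boxOne_cls hF,
      comp_cls ((isMultilinear_adjoinForest hf hx).2 hG) (isMultilinear_boxOne hF)]
    rw [adjoinForest, adjoinForest, graft_snoc]
    congr 2
    funext i
    simp only [graft, map_lift]

theorem isMultilinear_perm [Fintype S] (e : S' ≃ S) :
    IsMultilinear fun t => FreeMagma.of (e.symm t) := by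
  intro s
  simp [Equiv.symm_apply_eq]

/-- The adjoined leaf and the other letters are relabelled separately; `he` says that `e'` is the
restriction of `e` to the latter. -/
theorem perm_comp_adjoin {A' : Type} [DecidableEq A'] [Fintype A] [Fintype S] {f : A → S}
    (hf : Function.Injective f) {x : S} (hx : ∀ s, s ∈ Set.range f ↔ s ≠ x) {f' : A' → S'}
    (e : S' ≃ S) (e' : A' ≃ A) (he : ∀ a, f (e' a) = e (f' a)) (y : Hom A (Fin n)) :
    comp _ _ _ (perm e) (adjoin f x y) =
      adjoin f' (e.symm x) (comp _ _ _ (perm e') y) := by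
  induction y using hom_induction with
  | hadd x y hx hy => simp only [map_add, hx, hy]
  | hsmul c x hx => simp only [map_smul, hx]
  | h0 => simp
  | hcls F hF =>
    rw [perm, perm, adjoin_cls _ _ hF, comp_cls (isMultilinear_perm e)
      ((isMultilinear_adjoinForest hf hx).2 hF), comp_cls (isMultilinear_perm e') hF,
      adjoin_cls _ _ ((isMultilinear_perm e').graft hF)]
    congr 1
    funext i
    induction i using Fin.lastCases with
    | last => simp [adjoinForest, graft]
    | cast i =>
      simp only [adjoinForest, graft, Fin.snoc_castSucc, lift_map, map_lift, FreeMagma.map_of]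
      congr 2
      funext a
      congr 1
      rw [e.symm_apply_eq, ← he, e'.apply_symm_apply]

/-- The class of the forest whose relabelling along `f` is `F`, and `0` if there is none. -/
def unmap (f : A → S) (F : Fin n → FreeMagma S) : Hom A (Fin n) :=
  open Classical in
  if h : ∃ G : Fin n → FreeMagma A, ∀ i, FreeMagma.map f (G i) = F i then cls h.choose else 0

theorem freeMagma_map_injective {f : A → S} (hf : Function.Injective f) :
    Function.Injective (FreeMagma.map f) := by
  intro a
  induction a with
  | ih1 x =>
    intro b h
    cases b with
    | of y =>
      injection h with h
      exact congrArg FreeMagma.of (hf h)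
    | mul b c => cases h
  | ih2 a a' ih ih' =>
    intro b h
    cases b with
    | of y => cases h
    | mul b c =>
      injection h with h1 h2
      rw [ih h1, ih' h2]
      rfl

/-- Relabelling along an injection is injective on trees, so the choice in `unmap` is no choice. -/
theorem unmap_map {f : A → S} (hf : Function.Injective f) (G : Fin n → FreeMagma A) :
    unmap f (fun i => FreeMagma.map f (G i)) = cls G := by
  have h : ∃ G' : Fin n → FreeMagma A, ∀ i, FreeMagma.map f (G' i) = FreeMagma.map f (G i) :=
    ⟨G, fun _ => rfl⟩
  rw [unmap, dif_pos h]
  congr 1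
  funext i
  exact freeMagma_map_injective hf (h.choose_spec i)

/-- The trees with all leaves labelled by values of `f`. -/
theorem exists_map_eq_iff {f : A → S} {a : FreeMagma S} :
    (∃ b, FreeMagma.map f b = a) ↔ ∀ s, s ∉ Set.range f → occ s a = 0 := by
  constructor
  · rintro ⟨b, rfl⟩ s hs
    exact occ_map_of_notMem hs b
  · induction a with
    | ih1 x =>
      intro h
      by_cases hx : x ∈ Set.range f
      · obtain ⟨y, rfl⟩ := hx
        exact ⟨FreeMagma.of y, by simp⟩
      · simpa using h x hx
    | ih2 a b iha ihb =>
      intro h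
      obtain ⟨a', rfl⟩ := iha fun s hs => by have := h s hs; rw [occ_mul] at this; omega
      obtain ⟨b', rfl⟩ := ihb fun s hs => by have := h s hs; rw [occ_mul] at this; omega
      exact ⟨a' * b', by simp⟩

/-- All trees in a relation have the same leaves, so either every term comes from `A` or none does.
In the first case a left inverse of `f` carries the relation back to `A`. -/
theorem unmap_rel {f : A → S} (hf : Function.Injective f) (F : Fin n → FreeMagma S) (t : Fin n)
    {l : List (FreeMagma S)} (hl : TreeRel l) :
    (l.map fun a => unmap f (Function.update F t a)).sum = 0 := by
  by_cases h : ∃ a ∈ l, ∃ G : Fin n → FreeMagma A,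
      ∀ i, FreeMagma.map f (G i) = Function.update F t a i
  · obtain ⟨a, ha, G, hG⟩ := h
    -- The tree `G t` has a leaf, so `A` is nonempty, as `Function.invFun` requires.
    obtain ⟨x⟩ : Nonempty A := by
      by_contra hA
      rw [not_nonempty_iff] at hA
      induction G t with
      | ih1 x => exact hA.false x
      | ih2 _ _ h _ => exact h
    have : Nonempty A := ⟨x⟩
    have hb : ∀ b ∈ l, unmap f (Function.update F t b) =
        cls (Function.update G t (FreeMagma.map (Function.invFun f) b)) := by
      intro b hb
      obtain ⟨b', rfl⟩ : ∃ b', FreeMagma.map f b' = b := by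
        rw [exists_map_eq_iff]
        intro s hs
        rw [hl.occ_eq s b hb a ha]
        have := hG t
        rw [Function.update_self] at this
        exact exists_map_eq_iff.1 ⟨_, this⟩ s hs
      rw [map_map_of_leftInverse (Function.leftInverse_invFun hf), ← unmap_map hf]
      congr 1
      funext i
      by_cases hi : i = t
      · subst hi; simp
      · simpa [hi] using (hG i).symm
    rw [List.map_congr_left hb]
    have := cls_rel G t (hl.map_hom (FreeMagma.map (Function.invFun f)))
    rwa [List.map_map] at this
  · refine List.sum_eq_zero fun y hy => ?_
    obtain ⟨a, ha, rfl⟩ := List.mem_map.1 hy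
    rw [unmap, dif_neg fun h' => h ⟨a, ha, h'⟩]

/-- Every relation takes place at a bracket. Hence the condition that the last tree is a given leaf
is compatible with the relations, which makes `unleaf` well defined. -/
theorem TreeRel.exists_mul_eq {S : Type} {l : List (FreeMagma S)} (hl : TreeRel l) :
    ∀ a ∈ l, ∃ b c, a = b * c := by
  cases hl with
  | anti a b => simp
  | jacobi a b c => simp
  | left c _ => simp only [List.mem_map]; rintro _ ⟨a, _, rfl⟩; exact ⟨a, c, rfl⟩
  | right c _ => simp only [List.mem_map]; rintro _ ⟨a, _, rfl⟩; exact ⟨c, a, rfl⟩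

variable [Fintype S] [Fintype S']

/-- The summand of the convolution product in which the single leaf is `x`. -/
def ConvUnit.inj (n : ℕ) (x : S) :
    Hom {y // y ∈ Finset.univ.erase x} (Fin n) →ₗ[ℚ] ConvUnit S n :=
  DirectSum.lof ℚ _ (fun A : Finset S =>
      TensorProduct ℚ (Hom {x // x ∈ A} (Fin n)) (UnitOperad {x // ¬ x ∈ A}))
      (Finset.univ.erase x) ∘ₗ
    (TensorProduct.mk ℚ _ _).flip (Finsupp.single ⟨⟨x, by simp⟩, fun y => by
      have := y.2
      simp only [Finset.mem_erase, Finset.mem_univ, and_true, not_not] at this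
      exact Subtype.ext this⟩ 1)

/-- A linear map out of the convolution product is determined by its values on the summands. -/
theorem ConvUnit.hom_ext {M : Type} [AddCommMonoid M] [Module ℚ M] {f g : ConvUnit S n →ₗ[ℚ] M}
    (h : ∀ (x : S) (y : Hom {y // y ∈ Finset.univ.erase x} (Fin n)),
      f (ConvUnit.inj n x y) = g (ConvUnit.inj n x y)) : f = g := by
  refine DirectSum.linearMap_ext _ fun A => TensorProduct.ext' fun y u => ?_
  induction u using Finsupp.induction_linear with
  | zero => simp
  | add u v hu hv => rw [TensorProduct.tmul_add, map_add, map_add, hu, hv]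
  | single u c =>
    obtain ⟨⟨x, hxA⟩, hx⟩ := u
    -- A basis vector of `I` exists only if the complement of `A` is the single point `x`.
    obtain rfl : A = Finset.univ.erase x := by
      ext s
      simp only [Finset.mem_erase, Finset.mem_univ, and_true]
      refine ⟨fun hs hsx => hxA (hsx ▸ hs), fun hs => ?_⟩
      by_contra hsA
      exact hs (congrArg Subtype.val (hx ⟨s, hsA⟩))
    have := congrArg (fun z => c • z) (h x y)
    simpa [ConvUnit.inj, ← map_smul, ← TensorProduct.tmul_smul] using this

theorem mem_range_val_erase (x s : S) :
    s ∈ Set.range (Subtype.val : {y // y ∈ Finset.univ.erase x} → S) ↔ s ≠ x := by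
  simp

theorem convIncl_inj (x : S) (y : Hom {y // y ∈ Finset.univ.erase x} (Fin n)) :
    convIncl S n (ConvUnit.inj n x y) = adjoin Subtype.val x y := by
  simp [convIncl, ConvUnit.inj]

theorem left_inj {n' : ℕ} (φ : Hom (Fin n) (Fin n')) (x : S)
    (y : Hom {y // y ∈ Finset.univ.erase x} (Fin n)) :
    ConvUnit.left φ (ConvUnit.inj n x y) = ConvUnit.inj n' x (comp _ _ _ y φ) := by
  simp [ConvUnit.left, ConvUnit.inj]

theorem convIncl_left {n' : ℕ} (φ : Hom (Fin n) (Fin n')) (z : ConvUnit S n) :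
    convIncl S n' (ConvUnit.left φ z) = comp _ _ _ (convIncl S n z) (boxOne n n' φ) := by
  suffices h : convIncl S n' ∘ₗ ConvUnit.left φ =
      (comp _ _ _).flip (boxOne n n' φ) ∘ₗ convIncl S n from LinearMap.congr_fun h z
  refine ConvUnit.hom_ext fun x y => ?_
  simp only [LinearMap.comp_apply, left_inj, convIncl_inj, LinearMap.flip_apply]
  exact adjoin_comp Subtype.val_injective (mem_range_val_erase x) y φ

theorem convIncl_right (e : S' ≃ S) (z : ConvUnit S n) :
    convIncl S' n (ConvUnit.right e z) = comp _ _ _ (perm e) (convIncl S n z) := by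
  suffices h : convIncl S' n ∘ₗ ConvUnit.right e =
      comp _ _ _ (perm e) ∘ₗ convIncl S n from LinearMap.congr_fun h z
  refine ConvUnit.hom_ext fun x y => ?_
  simp only [LinearMap.comp_apply, convIncl_inj]
  rw [perm_comp_adjoin Subtype.val_injective (mem_range_val_erase x)
    -- The subset is written as an image under `e.symm`, the form in which `ConvUnit.right` indexes
    -- its target summand.
    (f' := (Subtype.val : {y // y ∈ (Finset.univ.erase x).map e.symm.toEmbedding} → S')) e
    (e.subtypeEquiv (by simp [Equiv.eq_symm_apply])) (fun _ => rfl)]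
  simp [ConvUnit.right, ConvUnit.inj, convIncl, UnitOperad.relabel, Finsupp.lmapDomain_apply]

open Classical in
/-- The projection of `Hom S (n + 1)` to the forests whose last tree is the leaf `x`. -/
def unleaf (n : ℕ) (x : S) :
    Hom S (Fin (n + 1)) →ₗ[ℚ] Hom {y // y ∈ Finset.univ.erase x} (Fin n) :=
  liftHom (fun F => if F (Fin.last n) = FreeMagma.of x then
      unmap Subtype.val (Fin.init (α := fun _ => FreeMagma S) F) else 0) (by
    intro F t l hl
    induction t using Fin.lastCases with
    | last =>
      refine List.sum_eq_zero fun y hy => ?_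
      obtain ⟨a, ha, rfl⟩ := List.mem_map.1 hy
      obtain ⟨b, c, rfl⟩ := hl.exists_mul_eq a ha
      refine if_neg ?_
      rw [Function.update_self]
      intro h
      cases h
    | cast t =>
      simp only [ne_eq, (Fin.castSucc_ne_last t).symm, not_false_eq_true, Function.update_of_ne,
        Fin.init_update_castSucc]
      split_ifs
      · exact unmap_rel Subtype.val_injective _ t hl
      · simp)

theorem unleaf_adjoin (x : S) (y : Hom {y // y ∈ Finset.univ.erase x} (Fin n)) :
    unleaf n x (adjoin Subtype.val x y) = y := by
  induction y using hom_induction with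
  | hadd x y hx hy => simp only [map_add, hx, hy]
  | hsmul c x hx => simp only [map_smul, hx]
  | h0 => simp
  | hcls F hF =>
    rw [adjoin_cls _ _ hF, unleaf, liftHom_cls _ _
      ((isMultilinear_adjoinForest Subtype.val_injective (mem_range_val_erase x)).2 hF),
      if_pos (by simp [adjoinForest]), adjoinForest, Fin.init_snoc,
      unmap_map Subtype.val_injective]

theorem unleaf_adjoin_of_ne {x x' : S} (h : x' ≠ x)
    (y : Hom {y // y ∈ Finset.univ.erase x} (Fin n)) :
    unleaf n x' (adjoin Subtype.val x y) = 0 := by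
  induction y using hom_induction with
  | hadd x y hx hy => rw [map_add, map_add, hx, hy, add_zero]
  | hsmul c x hx => rw [map_smul, map_smul, hx, smul_zero]
  | h0 => simp
  | hcls F hF =>
    rw [adjoin_cls _ _ hF, unleaf, liftHom_cls _ _
      ((isMultilinear_adjoinForest Subtype.val_injective (mem_range_val_erase x)).2 hF), if_neg]
    rw [adjoinForest, Fin.snoc_last]
    intro h'
    injection h' with h'
    exact h h'.symm

/-- The maps `unleaf n x'` and `adjoin Subtype.val x` are dual to each other: their composite is the
identity if `x' = x` and zero otherwise. -/
theorem sum_inj_unleaf_convIncl (z : ConvUnit S n) :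
    ∑ x, ConvUnit.inj n x (unleaf n x (convIncl S n z)) = z := by
  suffices h : ∑ x, ConvUnit.inj n x ∘ₗ unleaf n x ∘ₗ convIncl S n = LinearMap.id by
    simpa using LinearMap.congr_fun h z
  refine ConvUnit.hom_ext fun x y => ?_
  simp only [LinearMap.sum_apply, LinearMap.comp_apply, convIncl_inj, LinearMap.id_apply]
  rw [Finset.sum_eq_single x, unleaf_adjoin]
  · intro x' _ hx'
    rw [unleaf_adjoin_of_ne hx', map_zero]
  · simp

theorem convIncl_injective : Function.Injective (convIncl S n) :=
  Function.LeftInverse.injective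
    (g := fun z => ∑ x, ConvUnit.inj n x (unleaf n x z)) sum_inj_unleaf_convIncl

theorem range_convIncl : LinearMap.range (convIncl S n) = lastLeaf S n := by
  apply le_antisymm
  · suffices h : (lastLeaf S n).mkQ ∘ₗ convIncl S n = 0 by
      rw [LinearMap.range_le_iff_comap, ← LinearMap.ker_eq_top.2 h, LinearMap.ker_comp,
        Submodule.ker_mkQ]
    refine ConvUnit.hom_ext fun x y => ?_
    rw [LinearMap.comp_apply, convIncl_inj, LinearMap.zero_apply]
    induction y using hom_induction with
    | hadd x y hx hy => rw [map_add, map_add, hx, hy, add_zero]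
    | hsmul c x hx => rw [map_smul, map_smul, hx, smul_zero]
    | h0 => simp
    | hcls F hF =>
      rw [adjoin_cls _ _ hF, Submodule.mkQ_apply, Submodule.Quotient.mk_eq_zero]
      exact Submodule.subset_span ⟨_, x,
        (isMultilinear_adjoinForest Subtype.val_injective (mem_range_val_erase x)).2 hF,
        by simp [adjoinForest], rfl⟩
  · rw [lastLeaf, Submodule.span_le]
    rintro _ ⟨F, x, hF, hx, rfl⟩
    -- The last leaf already uses up `x`, so by multilinearity the other trees have their leaves in
    -- the complement of `x`.
    have h : ∀ i : Fin n, ∃ b : FreeMagma {y // y ∈ Finset.univ.erase x},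
        FreeMagma.map Subtype.val b = F i.castSucc := by
      intro i
      rw [exists_map_eq_iff]
      intro s hs
      obtain rfl : s = x := not_not.1 (mt (mem_range_val_erase x s).2 hs)
      have h1 := hF s
      rw [Fin.sum_univ_castSucc, hx, occ_of, if_pos rfl, Nat.add_eq_right,
        Finset.sum_eq_zero_iff] at h1
      exact h1 i (Finset.mem_univ i)
    choose G hG using h
    have hFG : adjoinForest Subtype.val x G = F := by
      rw [adjoinForest, ← hx]
      simp only [hG]
      exact Fin.snoc_init_self F
    refine ⟨ConvUnit.inj n x (cls G), ?_⟩
    rw [convIncl_inj, adjoin_cls, hFG]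
    rwa [← hFG, isMultilinear_adjoinForest Subtype.val_injective (mem_range_val_erase x)] at hF

end Convolution

end LieForest

/-! ### The induced bimodule structure and its uniqueness -/

namespace CatLie

open LieForest

theorem proj_of_mem {m n : CatLie} (z : deltaOne m n) : proj m n z = z :=
  Subtype.ext (projAux_of_mem z.2)

theorem proj_lact {m n n' : CatLie} (φ : n ⟶ n') (z : m ⟶ shift.obj n) :
    (proj m n' (z ≫ shift.map φ) : m ⟶ shift.obj n') = (proj m n z).1 ≫ shift.map φ :=
  projAux_comp_boxOne z φ

theorem proj_ract {m' m n : CatLie} (φ : m' ⟶ m) (z : m ⟶ shift.obj n) :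
    proj m' n (φ ≫ (proj m n z).1) = proj m' n (φ ≫ z) :=
  Subtype.ext (projAux_comp_projAux φ z)

/-- Since `z = π z`, left linearity of `π` exhibits the composite as a value of `π`. -/
theorem comp_shift_map_mem {m n n' : CatLie} (φ : n ⟶ n') (z : deltaOne m n) :
    z.1 ≫ shift.map φ ∈ deltaOne m n' := by
  have h := proj_lact φ z.1
  rw [proj_of_mem] at h
  exact h ▸ Subtype.property _

/-- The bimodule structure on `δ⁽¹⁾ CatLie`. -/
def deltaOneBimodule : LinearBimodule CatLie (fun m n => deltaOne m n) where
  lact {m n n'} := LinearMap.mk₂ ℚ (fun φ z => ⟨z.1 ≫ shift.map φ, comp_shift_map_mem φ z⟩)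
    (fun _ _ _ => Subtype.ext (by simp [shift.map_add]))
    (fun _ _ _ => Subtype.ext (by simp [shift.map_smul]))
    (fun _ _ _ => Subtype.ext (by simp))
    (fun _ _ _ => Subtype.ext (by simp))
  ract {m' m n} := LinearMap.mk₂ ℚ (fun z φ => proj m' n (φ ≫ z.1))
    (fun _ _ _ => by simp)
    (fun _ _ _ => by simp)
    (fun _ _ _ => by simp)
    (fun _ _ _ => by simp)
  id_lact b := Subtype.ext (by simp)
  comp_lact φ ψ b := Subtype.ext (by simp)
  ract_id b := by simp [proj_of_mem]
  -- Associativity is where `proj_ract` enters: the inner `π` can be dropped under the outer one.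
  ract_comp b ψ φ := by
    simp only [LinearMap.mk₂_apply, proj_ract, Category.assoc]
  lact_ract φ b ψ := Subtype.ext (by
    simp only [LinearMap.mk₂_apply, ← proj_lact, Category.assoc])

theorem isMorphism_proj : delta.IsMorphism deltaOneBimodule proj where
  map_lact φ b := Subtype.ext (proj_lact φ b)
  map_ract b φ := (proj_ract φ b).symm

/-- Applying the morphism property to `z` viewed in `δ`, where `π z = z`, leaves no freedom for the
action; the right action is determined in the same way. -/
theorem lact_eq_of_isMorphism {X : LinearBimodule CatLie (fun m n => deltaOne m n)}
    (hX : delta.IsMorphism X proj) {m n n' : CatLie} (φ : n ⟶ n') (z : deltaOne m n) :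
    (X.lact φ z : m ⟶ shift.obj n') = z.1 ≫ shift.map φ := by
  have h := congrArg Subtype.val (hX.map_lact φ z.1)
  rw [proj_of_mem] at h
  rw [← h]
  exact (proj_lact φ z.1).trans (by rw [proj_of_mem])

theorem ract_eq_of_isMorphism {X : LinearBimodule CatLie (fun m n => deltaOne m n)}
    (hX : delta.IsMorphism X proj) {m' m n : CatLie} (z : deltaOne m n) (φ : m' ⟶ m) :
    X.ract z φ = proj m' n (φ ≫ z.1) := by
  have h := hX.map_ract z.1 φ
  rw [proj_of_mem] at h
  exact h.symm

end CatLie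

end

theorem mainTheorem6 :
    -- `δ⁽¹⁾ CatLie` is the copy of `CatLie ⊙ I` in `δ CatLie`, as a left `CatLie`-module and a
    -- right `ℚΣ`-module
    (∀ m n : CatLie, Function.Injective (CatLie.inclI m n) ∧
      LinearMap.range (CatLie.inclI m n) = CatLie.deltaOne m n) ∧
    (∀ (m n n' : CatLie) (φ : n ⟶ n') (z : CatLie.ConvI m n),
      CatLie.inclI m n' (LieForest.ConvUnit.left φ z) =
        CatLie.delta.lact φ (CatLie.inclI m n z)) ∧
    (∀ (m n : CatLie) (σ : Equiv.Perm (Fin m.arity)) (z : CatLie.ConvI m n),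
      CatLie.inclI m n (LieForest.ConvUnit.right σ z) =
        CatLie.delta.ract (CatLie.inclI m n z) (CatLie.ofPerm σ)) ∧
    -- `π` is a retraction onto `δ⁽¹⁾ CatLie`
    (∀ (m n : CatLie) (z : CatLie.deltaOne m n), CatLie.proj m n z = z) ∧
    -- the bimodule structure
    (∃! X : LinearBimodule CatLie (fun m n => CatLie.deltaOne m n),
      CatLie.delta.IsMorphism X CatLie.proj) ∧
    -- the description of its two actions
    (∀ X : LinearBimodule CatLie (fun m n => CatLie.deltaOne m n),
      CatLie.delta.IsMorphism X CatLie.proj →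
      (∀ (m n n' : CatLie) (φ : n ⟶ n') (z : CatLie.deltaOne m n),
        (X.lact φ z : m ⟶ CatLie.shift.obj n') = z.1 ≫ CatLie.shift.map φ) ∧
      (∀ (m' m n : CatLie) (z : CatLie.deltaOne m n) (φ : m' ⟶ m),
        X.ract z φ = CatLie.proj m' n (φ ≫ z.1))) := by
  refine ⟨fun m n => ⟨LieForest.convIncl_injective, LieForest.range_convIncl⟩,
    fun m n n' φ z => LieForest.convIncl_left φ z, fun m n σ z => LieForest.convIncl_right σ z,
    fun m n z => CatLie.proj_of_mem z,
    ⟨CatLie.deltaOneBimodule, CatLie.isMorphism_proj, fun X hX => ?_⟩,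
    fun X hX => ⟨fun m n n' φ z => CatLie.lact_eq_of_isMorphism hX φ z,
      fun m' m n z φ => CatLie.ract_eq_of_isMorphism hX z φ⟩⟩
  have hl : @X.lact = @CatLie.deltaOneBimodule.lact := by
    funext m n n'
    exact LinearMap.ext₂ fun φ z => Subtype.ext (CatLie.lact_eq_of_isMorphism hX φ z)
  have hr : @X.ract = @CatLie.deltaOneBimodule.ract := by
    funext m' m n
    exact LinearMap.ext₂ fun z φ => CatLie.ract_eq_of_isMorphism hX z φ
  exact LinearBimodule.ext hl hr
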